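/- **Setting.** For $\gamma\in[0,\infty)$ let $\phi(\gamma)=E\big[(X-E[X\mid Y])^2\big]$, where $X$ is equiprobable on $\{+1,-1\}$, $Y=\sqrt{\gamma}\,X+N$, and $N\sim\mathcal N(0,1)$ is independent of $X$; put $\phi(\infty)=0$. Let $L_\gamma=2\sqrt{\gamma}\,Y$ be the log likelihood ratio of $X$ given $Y$ (so $L_\gamma\sim\mathcal N(2\gamma x,4\gamma)$ given $X=x$), and let $L_\infty=X\cdot\infty$. For a nonempty binary code $\mathbf C\subseteq\{+1,-1\}^n$, $n\ge 1$, of rate $\frac1n\log_2|\mathbf C|$, let $\vec X$ be uniform on $\mathbf C$ and let the a priori information come from a Gaussian channel with signal to noise ratio $\gamma_{ap}$: $Y_j=\sqrt{\gamma_{ap}}\,X_j+N_j$, with $N_1,\dots,N_n$ i.i.d. $\mathcal N(0,1)$ and independent of $\vec X$. The extrinsic log likelihood ratio of the $k$-th symbol is $$L_{ext,k}=\log\frac{P\big(X_k=1\mid (Y_j)_{j\ne k}\big)}{P\big(X_k=-1\mid (Y_j)_{j\ne k}\big)}\in[-\infty,\infty].$$ Let $(\mathbf C_m)$ be a sequence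 of such codes whose rates converge to $R$ (for a single code of rate $R$, take a constant sequence). Let $D\subseteq[0,\infty)$ have a Lebesgue-null complement in $[0,\infty)$, let $\gamma_{ext}:D\to[0,\infty]$, and suppose that for every $\gamma_{ap}\in D$ the extrinsic information is that of a Gaussian channel with signal to noise ratio $\gamma_{ext}(\gamma_{ap})$: if $K$ is a uniformly random position, independent of codeword and noise, then the law of $(X_K,L_{ext,K})$ for $\mathbf C_m$ converges weakly, as $m\to\infty$, to the law of $(X,L_{\gamma_{ext}(\gamma_{ap})})$ (for a constant sequence: is equal to it). **Lemma.** View $\gamma_{ap}$ as a function of $\gamma_{ext}$ along the transfer curve, with the jumps of the curve filled in by segments on which $\gamma_{ap}$ is constant, that is, for $s\in[0,\infty)$, $$\gamma_{ap}(s)=\inf\{t\in D:\ \gamma_{ext}(t)\ge s\}\in[0,\infty],\qquad \inf\emptyset=\infty .$$ Then $s\mapsto\phi(\gamma_{ap}(s)+s)$ is integrable on $(0,\infty)$ and $$\int_0^\infty \phi(\gamma_{ap}+\gamma_{ext})\,d\gamma_{ext}=\int_0^\infty\phi\big(\gamma_{ap}(s)+s\big)\,ds=(1-R)\ln 4 .$$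 -/

import Mathlib

open MeasureTheory ProbabilityTheory Filter Topology Set
open scoped NNReal ENNReal BoundedContinuousFunction

namespace MSEChart

/-- The antipodal symbol `+1` or `-1` that carries a bit. -/
def bpsk (b : Bool) : ℝ := if b then 1 else -1

/-! ### A single equiprobable bit over an additive white Gaussian noise channel -/

/-- Joint law of an equiprobable bit and an independent standard Gaussian noise sample. -/
noncomputable def bitLaw : Measure (Bool × ℝ) :=
  (uniformOn (Set.univ : Set Bool)).prod (gaussianReal 0 1)

/-- The channel output `Y = √γ X + N`. -/
noncomputable def bitOutput (γ : ℝ≥0) (ω : Bool × ℝ) : ℝ :=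
  √(γ : ℝ) * bpsk ω.1 + ω.2

/-- The estimate `E[X | Y]`. -/
noncomputable def bitEstimate (γ : ℝ≥0) : Bool × ℝ → ℝ :=
  bitLaw[fun ω => bpsk ω.1 | MeasurableSpace.comap (bitOutput γ) inferInstance]

/-- The minimum mean squared error `φ(γ) = E[(X - E[X | Y])²]`. An infinite signal to noise ratio
stands for a noiseless channel, whose error is zero. -/
noncomputable def phi (γ : ℝ≥0∞) : ℝ :=
  if γ = ⊤ then 0
  else ∫ ω, (bpsk ω.1 - bitEstimate γ.toNNReal ω) ^ 2 ∂bitLaw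

/-- The log likelihood ratio of the bit given `Y = √γ X + N`, that is `2 √γ Y`, which has law
`𝒩(2 γ x, 4 γ)` when `X = x`. It is `±∞`, with the sign of the bit, over a noiseless channel. -/
noncomputable def gaussLLR (γ : ℝ≥0∞) (ω : Bool × ℝ) : EReal :=
  if γ = ⊤ then (if ω.1 then ⊤ else ⊥)
  else ((2 * √(γ.toNNReal : ℝ) * bitOutput γ.toNNReal ω : ℝ) : EReal)

/-! ### A binary code -/

variable {n : ℕ}

/-- The rate of a code of length `n`, in bits per symbol. -/
noncomputable def rate (C : Finset (Fin n → Bool)) : ℝ := Real.logb 2 (C.card : ℝ) / n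

/-- Joint law of a uniformly distributed codeword and of independent standard Gaussian noise. -/
noncomputable def codeLaw (C : Finset (Fin n → Bool)) :
    Measure ((Fin n → Bool) × (Fin n → ℝ)) :=
  (uniformOn (C : Set (Fin n → Bool))).prod (Measure.pi fun _ => gaussianReal 0 1)

/-- The a priori observations of all the symbols but the `k`-th: `Y_j = √γ X_j + N_j`, `j ≠ k`. -/
noncomputable def othersOutput (γ : ℝ≥0) (k : Fin n) (ω : (Fin n → Bool) × (Fin n → ℝ)) :
    {j : Fin n // j ≠ k} → ℝ :=
  fun j => √(γ : ℝ) * bpsk (ω.1 j) + ω.2 j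

/-- The conditional probability that the `k`-th bit of the codeword is `b`, given the a priori
observations of all the other symbols. -/
noncomputable def extProb (C : Finset (Fin n → Bool)) (γ : ℝ≥0) (k : Fin n) (b : Bool) :
    (Fin n → Bool) × (Fin n → ℝ) → ℝ :=
  (codeLaw C)[Set.indicator {ω | ω.1 k = b} (fun _ => (1 : ℝ)) |
    MeasurableSpace.comap (othersOutput γ k) inferInstance]

/-- The extrinsic log likelihood ratio of the `k`-th bit; it is infinite when the bit is
determined by the other observations. -/
noncomputable def extLLR (C : Finset (Fin n → Bool)) (γ : ℝ≥0) (k : Fin n)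
    (ω : (Fin n → Bool) × (Fin n → ℝ)) : EReal :=
  ENNReal.log (ENNReal.ofReal (extProb C γ k true ω)) -
    ENNReal.log (ENNReal.ofReal (extProb C γ k false ω))

/-- Expectation of a function of a bit and of its extrinsic log likelihood ratio, averaged over
the `n` positions of the code. -/
noncomputable def extMean (C : Finset (Fin n → Bool)) (γ : ℝ≥0) (f : Bool × EReal → ℝ) : ℝ :=
  (∑ k : Fin n, ∫ ω, f (ω.1 k, extLLR C γ k ω) ∂codeLaw C) / n

/-! ### The Gaussian model and the transfer curve -/

/-- When the a priori information comes from a Gaussian channel of signal to noise ratio `γap`,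
the extrinsic information about the code symbols is that of a Gaussian channel of signal to noise
ratio `γext`: the law of (bit, extrinsic log likelihood ratio), over the positions of the code,
converges weakly, along the sequence of codes, to the law of (bit, log likelihood ratio) for an
equiprobable bit sent over that channel. For a constant sequence the two laws are equal. -/
def ExtrinsicIsGaussian {len : ℕ → ℕ} (C : ∀ m, Finset (Fin (len m) → Bool))
    (γap : ℝ≥0) (γext : ℝ≥0∞) : Prop :=
  ∀ f : (Bool × EReal) →ᵇ ℝ,
    Tendsto (fun m => extMean (C m) γap f) atTop
      (𝓝 (∫ ω, f (ω.1, gaussLLR γext ω) ∂bitLaw))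

/-- The a priori signal to noise ratio as a function of the extrinsic one, along the transfer curve
`γap ↦ γext γap`, `γap ∈ D`, whose jumps are filled in by segments on which `γap` is constant. It is
`∞` at the values that lie above the whole curve. -/
noncomputable def apOfExt (D : Set ℝ≥0) (γext : ℝ≥0 → ℝ≥0∞) (s : ℝ≥0∞) : ℝ≥0∞ :=
  ⨅ t ∈ {t : ℝ≥0 | t ∈ D ∧ s ≤ γext t}, (t : ℝ≥0∞)

end MSEChart

/-
Send the codeword over a Gaussian channel of signal to noise ratio `γ`. The estimate of the `k`-th
symbol from all the observations combines the extrinsic information about that symbol with its own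
observation, so under the Gaussian model its mean squared error tends to `φ(γ + γ_ext(γ))`. By the
I-MMSE relation, the integral over `γ` of the error of the whole codeword is twice its entropy,
which gives `∫ φ(t + γ_ext(t)) dt = R ln 4`; for a single uncoded bit, `∫ φ = ln 4`.

It remains to add the two integrals along the transfer curve. The part of the curve that lies below
the antidiagonal `t + s = v` projects onto a segment of length `τ` of the axis `t` and a segment of
length `v - τ` of the axis `s`. Hence the images of Lebesgue measure under `t ↦ t + γ_ext(t)` and
`s ↦ γ_ap(s) + s` add up to Lebesgue measure, for every monotone curve, and the two integrals of `φ`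
add up to `∫ φ = ln 4`. The curve is monotone because extrinsic errors decrease with `γ`.
-/

namespace MSEChart

section WithDensity

variable {E E' : Type*} [MeasurableSpace E] [MeasurableSpace E'] {ν : Measure E}
  {ν' : Measure E'} {O : E → E'} {l : E' → ℝ}

lemma integral_comp_eq_integral_mul_of_map_eq_withDensity (hO : Measurable O) (hl : Measurable l)
    (hl0 : ∀ y, 0 ≤ l y) (hmap : ν.map O = ν'.withDensity fun y => ENNReal.ofReal (l y))
    {G : E' → ℝ} (hG : Measurable G) : ∫ e, G (O e) ∂ν = ∫ y, l y * G y ∂ν' := by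
  rw [← integral_map hO.aemeasurable hG.aestronglyMeasurable, hmap,
    integral_withDensity_eq_integral_toReal_smul hl.ennreal_ofReal
      (ae_of_all _ fun _ => ENNReal.ofReal_lt_top)]
  simp only [ENNReal.toReal_ofReal (hl0 _), smul_eq_mul]

lemma integrable_of_map_eq_withDensity [IsFiniteMeasure ν] (hl : Measurable l)
    (hl0 : ∀ y, 0 ≤ l y) (hmap : ν.map O = ν'.withDensity fun y => ENNReal.ofReal (l y)) :
    Integrable l ν' := by
  refine ⟨hl.aestronglyMeasurable, ?_⟩
  rw [hasFiniteIntegral_iff_ofReal (ae_of_all _ hl0), ← setLIntegral_univ,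
    ← withDensity_apply _ MeasurableSet.univ, ← hmap]
  exact measure_lt_top _ _

end WithDensity

section ProductMeasure

variable {ι : Type*} [Fintype ι] {E : ι → Type*} [∀ i, MeasurableSpace (E i)]
  (μ : ∀ i, Measure (E i)) [∀ i, IsProbabilityMeasure (μ i)]

lemma lintegral_pi_prod {f : ∀ i, E i → ℝ≥0∞} (hf : ∀ i, Measurable (f i)) :
    ∫⁻ y, ∏ i, f i (y i) ∂Measure.pi μ = ∏ i, ∫⁻ t, f i t ∂μ i := by
  refine (lintegral_prod_eq_prod_lintegral_of_indepFun Finset.univ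
    (fun i (y : ∀ i, E i) => f i (y i)) (iIndepFun_pi (X := f) fun i => (hf i).aemeasurable)
    fun i => (hf i).comp (measurable_pi_apply i)).trans ?_
  exact Finset.prod_congr rfl fun i _ => (measurePreserving_eval μ i).lintegral_comp (hf i)

lemma pi_withDensity {f : ∀ i, E i → ℝ≥0∞} (hf : ∀ i, Measurable (f i))
    [∀ i, SigmaFinite ((μ i).withDensity (f i))] :
    (Measure.pi fun i => (μ i).withDensity (f i)) =
      (Measure.pi μ).withDensity (fun y => ∏ i, f i (y i)) := by
  refine Measure.pi_eq fun s hs => ?_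
  have hind (y : ∀ i, E i) : (univ.pi s).indicator (fun y => ∏ i, f i (y i)) y =
      ∏ i, (s i).indicator (f i) (y i) := by
    by_cases hy : y ∈ univ.pi s
    · rw [indicator_of_mem hy]
      exact Finset.prod_congr rfl fun i _ => (indicator_of_mem (hy i (mem_univ i)) _).symm
    · obtain ⟨i, hi⟩ : ∃ i, y i ∉ s i := by simpa [Set.mem_pi] using hy
      rw [indicator_of_notMem hy,
        Finset.prod_eq_zero (Finset.mem_univ i) (indicator_of_notMem hi _)]
  rw [withDensity_apply _ (MeasurableSet.univ_pi hs),
    ← lintegral_indicator (MeasurableSet.univ_pi hs), lintegral_congr hind,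
    lintegral_pi_prod μ fun i => (hf i).indicator (hs i)]
  exact Finset.prod_congr rfl fun i _ => by
    rw [withDensity_apply _ (hs i), lintegral_indicator (hs i)]

lemma measurePreserving_subtype_restrict (p : ι → Prop) [DecidablePred p] :
    MeasurePreserving (fun (y : ∀ i, E i) (j : Subtype p) => y j) (Measure.pi μ)
      (Measure.pi fun j : Subtype p => μ j) :=
  measurePreserving_fst.comp (measurePreserving_piEquivPiSubtypeProd μ p)

variable [DecidableEq ι]

lemma measurePreserving_update (j : ι) :
    MeasurePreserving (fun p : (∀ i, E i) × E j => Function.update p.1 j p.2)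
      ((Measure.pi μ).prod (μ j)) (Measure.pi μ) := by
  have hmeas : Measurable (fun p : (∀ i, E i) × E j => Function.update p.1 j p.2) := by
    fun_prop
  refine ⟨hmeas, (Measure.pi_eq fun s hs => ?_).symm⟩
  have hpre : (fun p : (∀ i, E i) × E j => Function.update p.1 j p.2) ⁻¹' univ.pi s =
      univ.pi (Function.update s j univ) ×ˢ s j := by
    ext p
    simp only [mem_preimage, mem_univ_pi, mem_prod,
      Function.forall_update_iff p.1 (fun i t => t ∈ s i),
      Function.forall_update_iff s (fun i u => p.1 i ∈ u), mem_univ, true_and]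
    exact and_comm
  rw [Measure.map_apply hmeas (MeasurableSet.univ_pi hs), hpre, Measure.prod_prod,
    Measure.pi_pi, ← Finset.prod_erase_mul _ _ (Finset.mem_univ j),
    ← Finset.prod_erase_mul _ (fun i => μ i (s i)) (Finset.mem_univ j), Function.update_self,
    measure_univ, mul_one]
  congr 1
  exact Finset.prod_congr rfl fun i hi => by
    rw [Function.update_of_ne (Finset.ne_of_mem_erase hi)]

lemma integral_eq_integral_update (j : ι) {F : (∀ i, E i) → ℝ}
    (hF : Integrable F (Measure.pi μ)) :
    ∫ y, F y ∂Measure.pi μ = ∫ y, ∫ t, F (Function.update y j t) ∂μ j ∂Measure.pi μ := by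
  have hpres := measurePreserving_update μ j
  conv_lhs => rw [← hpres.map_eq]
  rw [integral_map hpres.measurable.aemeasurable (by rw [hpres.map_eq]; exact hF.1)]
  exact integral_prod _ (hpres.integrable_comp_of_integrable hF)

end ProductMeasure

section GaussianReal

lemma gaussianReal_map_const_add_eq_withDensity (m : ℝ) :
    (gaussianReal 0 1).map (fun t => m + t) =
      (gaussianReal 0 1).withDensity fun y => ENNReal.ofReal (Real.exp (m * y - m ^ 2 / 2)) := by
  rw [gaussianReal_map_const_add, gaussianReal_of_var_ne_zero _ one_ne_zero,
    gaussianReal_of_var_ne_zero _ one_ne_zero,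
    ← withDensity_mul _ (measurable_gaussianPDF _ _) (by fun_prop)]
  congr 1
  ext y
  simp only [gaussianPDF, Pi.mul_apply]
  rw [← ENNReal.ofReal_mul (gaussianPDFReal_nonneg _ _ _)]
  simp only [gaussianPDFReal, NNReal.coe_one, mul_one, mul_assoc, ← Real.exp_add]
  congr 3
  ring

lemma hasDerivAt_gaussianPDFReal (t : ℝ) :
    HasDerivAt (gaussianPDFReal 0 1) (-(t * gaussianPDFReal 0 1 t)) t := by
  have hexp := (((hasDerivAt_id t).pow 2).neg.div_const 2).exp.const_mul (√(2 * Real.pi))⁻¹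
  have hpdf : gaussianPDFReal 0 1 = fun t => (√(2 * Real.pi))⁻¹ * Real.exp (-t ^ 2 / 2) := by
    ext t; simp [gaussianPDFReal]
  rw [hpdf]
  refine hexp.congr_deriv ?_
  simp only [Pi.neg_apply, Pi.pow_apply, id_eq, Nat.cast_ofNat]
  ring

lemma integrable_id_mul_gaussianPDFReal : Integrable fun t => t * gaussianPDFReal 0 1 t := by
  have hid := (memLp_id_gaussianReal (μ := 0) (v := 1) 1).integrable le_rfl
  rw [gaussianReal_of_var_ne_zero _ one_ne_zero, integrable_withDensity_iff_integrable_smul'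
    (measurable_gaussianPDF _ _) (ae_of_all _ fun _ => gaussianPDF_lt_top)] at hid
  exact hid.congr (ae_of_all _ fun t => by simp [toReal_gaussianPDF, mul_comm])

lemma stein_identity_gaussianReal {f f' : ℝ → ℝ} (hf : ∀ t, HasDerivAt f (f' t) t)
    (hf' : Measurable f') {B B' : ℝ} (hB : ∀ t, |f t| ≤ B) (hB' : ∀ t, |f' t| ≤ B') :
    ∫ t, t * f t ∂gaussianReal 0 1 = ∫ t, f' t ∂gaussianReal 0 1 := by
  rw [integral_gaussianReal_eq_integral_smul one_ne_zero,
    integral_gaussianReal_eq_integral_smul one_ne_zero]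
  have hfm : AEStronglyMeasurable f :=
    (continuous_iff_continuousAt.2 fun t => (hf t).continuousAt).aestronglyMeasurable
  have hpdf := integrable_gaussianPDFReal 0 1
  have hparts := integral_mul_deriv_eq_deriv_mul_of_integrable (fun t _ => hf t)
    (fun t _ => hasDerivAt_gaussianPDFReal t)
    (integrable_id_mul_gaussianPDFReal.neg.bdd_mul hfm (ae_of_all _ hB))
    (hpdf.bdd_mul hf'.aestronglyMeasurable (ae_of_all _ hB'))
    (hpdf.bdd_mul hfm (ae_of_all _ hB))
  simp only [smul_eq_mul]
  calc ∫ t, gaussianPDFReal 0 1 t * (t * f t)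
      = -∫ t, f t * -(t * gaussianPDFReal 0 1 t) := by
        rw [← integral_neg]; congr 1; ext t; ring
    _ = ∫ t, gaussianPDFReal 0 1 t * f' t := by
        rw [hparts, neg_neg]; congr 1; ext t; ring

lemma gaussianReal_prod_map_rotation {p q : ℝ} (hpq : p ^ 2 + q ^ 2 = 1) :
    ((gaussianReal 0 1).prod (gaussianReal 0 1)).map (fun z => p * z.1 + q * z.2) =
      gaussianReal 0 1 := by
  have hfst := gaussianReal_const_mul (P := (gaussianReal 0 1).prod (gaussianReal 0 1))
    measurePreserving_fst.hasLaw p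
  have hsnd := gaussianReal_const_mul (P := (gaussianReal 0 1).prod (gaussianReal 0 1))
    measurePreserving_snd.hasLaw q
  have hsum := gaussianReal_add_gaussianReal_of_indepFun
    (indepFun_prod (μ := gaussianReal 0 1) (ν := gaussianReal 0 1)
      (measurable_const_mul p) (measurable_const_mul q)) hfst.map_eq hsnd.map_eq
  have hvar : NNReal.mk (p ^ 2) (sq_nonneg p) * 1 + NNReal.mk (q ^ 2) (sq_nonneg q) * 1 = 1 := by
    ext; simpa using hpq
  rwa [hvar, mul_zero, mul_zero, add_zero] at hsum

end GaussianReal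

section Noise

variable {ι : Type*} [Fintype ι]

/-- The standard Gaussian measure on `ι → ℝ`. -/
noncomputable def stdNoise (ι : Type*) [Fintype ι] : Measure (ι → ℝ) :=
  Measure.pi fun _ => gaussianReal 0 1

instance : IsProbabilityMeasure (stdNoise ι) := by
  unfold stdNoise; infer_instance

lemma integrable_eval_stdNoise (j : ι) : Integrable (fun n => n j) (stdNoise ι) :=
  integrable_comp_eval (μ := fun _ : ι => gaussianReal 0 1) (f := id)
    ((memLp_id_gaussianReal (μ := 0) (v := 1) 1).integrable le_rfl)

lemma integrable_eval_sq_stdNoise (j : ι) : Integrable (fun n => n j ^ 2) (stdNoise ι) :=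
  integrable_comp_eval (μ := fun _ : ι => gaussianReal 0 1) (f := fun t => t ^ 2)
    ((memLp_id_gaussianReal (μ := 0) (v := 1) 2).integrable_sq)

lemma integral_eval_mul_stdNoise [DecidableEq ι] (j : ι) {f f' : (ι → ℝ) → ℝ}
    (hf : ∀ n t, HasDerivAt (fun t => f (Function.update n j t)) (f' (Function.update n j t)) t)
    (hfm : Measurable f) (hf' : Measurable f') {B B' : ℝ} (hB : ∀ n, |f n| ≤ B)
    (hB' : ∀ n, |f' n| ≤ B') :
    ∫ n, n j * f n ∂stdNoise ι = ∫ n, f' n ∂stdNoise ι := by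
  rw [stdNoise, integral_eq_integral_update _ j ((integrable_eval_stdNoise j).mul_bdd (c := B)
      hfm.aestronglyMeasurable (ae_of_all _ hB)),
    integral_eq_integral_update _ j
      (.of_bound hf'.aestronglyMeasurable B' (ae_of_all _ hB'))]
  refine integral_congr_ae (ae_of_all _ fun n => ?_)
  simp only [Function.update_self]
  exact stein_identity_gaussianReal (hf n) (hf'.comp (measurable_update n)) (fun t => hB _)
    (fun t => hB' _)

lemma measurePreserving_stdNoise_rotation {p q : ℝ} (hpq : p ^ 2 + q ^ 2 = 1) :
    MeasurePreserving (fun (z : (ι → ℝ) × (ι → ℝ)) j => p * z.1 j + q * z.2 j)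
      ((stdNoise ι).prod (stdNoise ι)) (stdNoise ι) := by
  have hpairs := (measurePreserving_arrowProdEquivProdArrow ℝ ℝ ι (fun _ => gaussianReal 0 1)
    (fun _ => gaussianReal 0 1)).symm
  have hcoord := measurePreserving_pi (fun _ : ι => (gaussianReal 0 1).prod (gaussianReal 0 1))
    (fun _ => gaussianReal 0 1) (f := fun _ z => p * z.1 + q * z.2) fun _ =>
      ⟨by fun_prop, gaussianReal_prod_map_rotation hpq⟩
  exact hcoord.comp hpairs

lemma integral_stdNoise_eq_integral_rotation {p q : ℝ} (hpq : p ^ 2 + q ^ 2 = 1)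
    {F : (ι → ℝ) → ℝ} (hF : Integrable F (stdNoise ι)) :
    ∫ n, F n ∂stdNoise ι =
      ∫ n, ∫ n', F (fun j => p * n j + q * n' j) ∂stdNoise ι ∂stdNoise ι := by
  have hrot := measurePreserving_stdNoise_rotation (ι := ι) hpq
  conv_lhs => rw [← hrot.map_eq]
  rw [integral_map hrot.measurable.aemeasurable (by rw [hrot.map_eq]; exact hF.1)]
  exact integral_prod _ (hrot.integrable_comp_of_integrable hF)

/-- The likelihood ratio of the observation `y`: the density of the law of `a s + n`, for
standard Gaussian noise `n`, with respect to the law of `n`. -/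
noncomputable def likelihood (a : ℝ) (s y : ι → ℝ) : ℝ :=
  Real.exp (∑ j, (a * s j * y j - (a * s j) ^ 2 / 2))

lemma likelihood_pos (a : ℝ) (s y : ι → ℝ) : 0 < likelihood a s y := Real.exp_pos _

@[fun_prop]
lemma continuous_likelihood (a : ℝ) (s : ι → ℝ) : Continuous (likelihood a s) := by
  unfold likelihood; fun_prop

@[fun_prop]
lemma measurable_likelihood (a : ℝ) (s : ι → ℝ) : Measurable (likelihood a s) :=
  (continuous_likelihood a s).measurable

lemma stdNoise_map_shift (a : ℝ) (s : ι → ℝ) :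
    (stdNoise ι).map (fun n j => a * s j + n j) =
      (stdNoise ι).withDensity (fun y => ENNReal.ofReal (likelihood a s y)) := by
  have hprob (j : ι) : IsProbabilityMeasure ((gaussianReal 0 1).map fun t => a * s j + t) :=
    Measure.isProbabilityMeasure_map (by fun_prop)
  rw [stdNoise, Measure.pi_map_pi (f := fun j t => a * s j + t) fun j => by fun_prop]
  simp_rw [gaussianReal_map_const_add_eq_withDensity] at hprob ⊢
  rw [pi_withDensity _ fun j => by fun_prop]
  congr 1
  ext y
  rw [likelihood, Real.exp_sum, ENNReal.ofReal_prod_of_nonneg fun j _ => (Real.exp_pos _).le]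

lemma integral_shift (a : ℝ) (s : ι → ℝ) {F : (ι → ℝ) → ℝ} (hF : Measurable F) :
    ∫ n, F (fun j => a * s j + n j) ∂stdNoise ι =
      ∫ y, likelihood a s y * F y ∂stdNoise ι :=
  integral_comp_eq_integral_mul_of_map_eq_withDensity (by fun_prop) (by fun_prop)
    (fun y => (likelihood_pos a s y).le) (stdNoise_map_shift a s) hF

lemma integrable_likelihood (a : ℝ) (s : ι → ℝ) : Integrable (likelihood a s) (stdNoise ι) :=
  integrable_of_map_eq_withDensity (by fun_prop) (fun y => (likelihood_pos a s y).le)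
    (stdNoise_map_shift a s)

lemma integrable_likelihood_mul (a : ℝ) (s : ι → ℝ) {F : (ι → ℝ) → ℝ} (hF : Measurable F)
    {B : ℝ} (hB : ∀ y, |F y| ≤ B) : Integrable (fun y => likelihood a s y * F y) (stdNoise ι) :=
  (integrable_likelihood a s).mul_bdd (c := B) hF.aestronglyMeasurable (ae_of_all _ hB)

end Noise

lemma abs_sum_mul_div_sum_le {A : Type*} {C : Finset A} (hC : C.Nonempty) {f w : A → ℝ}
    (hw : ∀ c, 0 < w c) {B : ℝ} (hB : ∀ c ∈ C, |f c| ≤ B) :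
    |(∑ c ∈ C, f c * w c) / ∑ c ∈ C, w c| ≤ B := by
  have hpos : 0 < ∑ c ∈ C, w c := Finset.sum_pos (fun c _ => hw c) hC
  rw [abs_div, abs_of_pos hpos, div_le_iff₀ hpos, Finset.mul_sum]
  refine (Finset.abs_sum_le_sum_abs _ _).trans (Finset.sum_le_sum fun c hc => ?_)
  rw [abs_mul, abs_of_pos (hw c)]
  exact mul_le_mul_of_nonneg_right (hB c hc) (hw c).le

lemma sum_mul_indicator_weightedMean {A E : Type*} {C : Finset A} (hC : C.Nonempty)
    {w : A → E → ℝ} (hw : ∀ c y, 0 < w c y) (f : A → ℝ) (S : Set E) (y : E) :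
    ∑ c ∈ C, w c y * S.indicator (fun y => (∑ c ∈ C, f c * w c y) / ∑ c ∈ C, w c y) y =
      ∑ c ∈ C, w c y * S.indicator (fun _ => f c) y := by
  by_cases hy : y ∈ S
  · simp only [indicator_of_mem hy, ← Finset.sum_mul]
    rw [mul_div_cancel₀ _ (Finset.sum_pos (fun c _ => hw c y) hC).ne']
    simp only [mul_comm]
  · simp only [indicator_of_notMem hy, mul_zero]

section PosteriorMean

variable {ι : Type*} [Fintype ι] {A : Type*}

/-- The likelihood of the observation `y` of `a x c + n`, summed over the hypotheses `c ∈ C`. -/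
noncomputable def evidence (C : Finset A) (a : ℝ) (x : A → ι → ℝ) (y : ι → ℝ) : ℝ :=
  ∑ c ∈ C, likelihood a (x c) y

/-- The posterior mean of `f c` given `a x c + n = y`, for `c` uniform on `C` and standard
Gaussian noise `n`, in the form given by Bayes' rule. -/
noncomputable def posteriorMean (C : Finset A) (a : ℝ) (x : A → ι → ℝ) (f : A → ℝ)
    (y : ι → ℝ) : ℝ :=
  (∑ c ∈ C, f c * likelihood a (x c) y) / evidence C a x y

variable {C : Finset A} {a : ℝ} {x : A → ι → ℝ} {f : A → ℝ}

lemma evidence_pos (hC : C.Nonempty) (a : ℝ) (x : A → ι → ℝ) (y : ι → ℝ) :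
    0 < evidence C a x y :=
  Finset.sum_pos (fun c _ => likelihood_pos a (x c) y) hC

lemma likelihood_le_evidence {c : A} (hc : c ∈ C) (y : ι → ℝ) :
    likelihood a (x c) y ≤ evidence C a x y :=
  Finset.single_le_sum (f := fun c => likelihood a (x c) y)
    (fun c _ => (likelihood_pos a (x c) y).le) hc

@[fun_prop]
lemma continuous_evidence (a : ℝ) (x : A → ι → ℝ) : Continuous (evidence C a x) := by
  unfold evidence; fun_prop

lemma continuous_posteriorMean (hC : C.Nonempty) : Continuous (posteriorMean C a x f) :=
  .div (by fun_prop) (by fun_prop) fun y => (evidence_pos hC a x y).ne'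

lemma posteriorMean_mul_evidence (hC : C.Nonempty) (y : ι → ℝ) :
    posteriorMean C a x f y * evidence C a x y = ∑ c ∈ C, f c * likelihood a (x c) y :=
  div_mul_cancel₀ _ (evidence_pos hC a x y).ne'

lemma abs_posteriorMean_le_of_le (hC : C.Nonempty) {B : ℝ} (hB : ∀ c ∈ C, |f c| ≤ B)
    (y : ι → ℝ) : |posteriorMean C a x f y| ≤ B :=
  abs_sum_mul_div_sum_le hC (fun c => likelihood_pos a (x c) y) hB

lemma abs_posteriorMean_le_sum (hC : C.Nonempty) (y : ι → ℝ) :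
    |posteriorMean C a x f y| ≤ ∑ c ∈ C, |f c| :=
  abs_posteriorMean_le_of_le hC (fun _ hc =>
    Finset.single_le_sum (f := fun c => |f c|) (fun _ _ => abs_nonneg _) hc) y

lemma integrable_posteriorMean (hC : C.Nonempty) :
    Integrable (posteriorMean C a x f) (stdNoise ι) :=
  .of_bound (continuous_posteriorMean hC).aestronglyMeasurable _
    (ae_of_all _ (abs_posteriorMean_le_sum hC))

lemma posteriorMean_sub_const (hC : C.Nonempty) (r : ℝ) (y : ι → ℝ) :
    posteriorMean C a x (fun c => f c - r) y = posteriorMean C a x f y - r := by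
  have hne := (evidence_pos hC a x y).ne'
  rw [posteriorMean, posteriorMean, eq_sub_iff_add_eq, div_add' _ _ _ hne, evidence,
    Finset.mul_sum, ← Finset.sum_add_distrib]
  simp only [sub_mul, sub_add_cancel]

lemma likelihood_shift (a : ℝ) (s s₀ n : ι → ℝ) :
    likelihood a s (fun j => a * s₀ j + n j) =
      likelihood a (s - s₀) n * likelihood a s₀ (fun j => a * s₀ j + n j) := by
  unfold likelihood
  rw [← Real.exp_add, ← Finset.sum_add_distrib]
  congr 1
  refine Finset.sum_congr rfl fun j _ => ?_
  simp only [Pi.sub_apply]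
  ring

lemma posteriorMean_shift (a : ℝ) (x : A → ι → ℝ) (f : A → ℝ) (s₀ n : ι → ℝ) :
    posteriorMean C a x f (fun j => a * s₀ j + n j) =
      posteriorMean C a (fun c => x c - s₀) f n := by
  simp only [posteriorMean, evidence, fun c => likelihood_shift a (x c) s₀ n, ← mul_assoc,
    ← Finset.sum_mul]
  exact mul_div_mul_right _ _ (likelihood_pos _ _ _).ne'

end PosteriorMean

section MeanSquaredError

variable {ι : Type*} [Fintype ι] {A : Type*}

/-- The mean squared error of the estimate `h` of `f c` from `a x c + n`, for `c` uniform on `C`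
and standard Gaussian noise `n`. -/
noncomputable def mse (C : Finset A) (a : ℝ) (x : A → ι → ℝ) (f : A → ℝ)
    (h : (ι → ℝ) → ℝ) : ℝ :=
  (∑ c ∈ C, ∫ n, (f c - h fun j => a * x c j + n j) ^ 2 ∂stdNoise ι) / C.card

/-- The minimum mean squared error of an estimate of `f c` from `a x c + n`. -/
noncomputable def mmse (C : Finset A) (a : ℝ) (x : A → ι → ℝ) (f : A → ℝ) : ℝ :=
  mse C a x f (posteriorMean C a x f)

variable {C : Finset A} {a : ℝ} {x : A → ι → ℝ} {f : A → ℝ} {h : (ι → ℝ) → ℝ} {B : ℝ}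

lemma abs_sq_sub_le {h r : ℝ} (hB : |h| ≤ B) : |(r - h) ^ 2| ≤ (|r| + B) ^ 2 := by
  rw [abs_pow]
  exact pow_le_pow_left₀ (abs_nonneg _) ((abs_sub r h).trans (by linarith)) 2

lemma mse_nonneg : 0 ≤ mse C a x f h :=
  div_nonneg (Finset.sum_nonneg fun _ _ => integral_nonneg fun _ => sq_nonneg _)
    (Nat.cast_nonneg _)

lemma integrable_likelihood_mul_sq_sub (hm : Measurable h) (hB : ∀ y, |h y| ≤ B) (c : A) :
    Integrable (fun y => likelihood a (x c) y * (f c - h y) ^ 2) (stdNoise ι) :=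
  integrable_likelihood_mul a (x c) (F := fun y => (f c - h y) ^ 2) (by fun_prop)
    fun y => abs_sq_sub_le (hB y)

lemma mse_eq_integral_likelihood (hm : Measurable h) (hB : ∀ y, |h y| ≤ B) :
    mse C a x f h =
      (∫ y, ∑ c ∈ C, likelihood a (x c) y * (f c - h y) ^ 2 ∂stdNoise ι) / C.card := by
  rw [mse, integral_finsetSum _ fun c _ => integrable_likelihood_mul_sq_sub hm hB c]
  congr 1
  exact Finset.sum_congr rfl fun c _ =>
    integral_shift a (x c) (F := fun y => (f c - h y) ^ 2) (by fun_prop)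

lemma sum_likelihood_mul_sq_sub (hC : C.Nonempty) (y : ι → ℝ) (r : ℝ) :
    ∑ c ∈ C, likelihood a (x c) y * (f c - r) ^ 2 =
      ∑ c ∈ C, likelihood a (x c) y * (f c - posteriorMean C a x f y) ^ 2 +
        (r - posteriorMean C a x f y) ^ 2 * evidence C a x y := by
  have hmean := posteriorMean_mul_evidence (a := a) (x := x) (f := f) hC y
  set m := posteriorMean C a x f y
  have hexpand (c : A) : likelihood a (x c) y * (f c - r) ^ 2 =
      likelihood a (x c) y * (f c - m) ^ 2 + ((r - m) ^ 2 * likelihood a (x c) y +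
        2 * (r - m) * (m * likelihood a (x c) y - f c * likelihood a (x c) y)) := by ring
  simp only [hexpand, Finset.sum_add_distrib, ← Finset.mul_sum, Finset.sum_sub_distrib]
  rw [← hmean, ← evidence]
  ring

lemma mmse_le_mse (hC : C.Nonempty) (hm : Measurable h) (hB : ∀ y, |h y| ≤ B) :
    mmse C a x f ≤ mse C a x f h := by
  have hpm := (continuous_posteriorMean (a := a) (x := x) (f := f) hC).measurable
  rw [mmse, mse_eq_integral_likelihood hm hB,
    mse_eq_integral_likelihood hpm (abs_posteriorMean_le_sum hC)]
  refine div_le_div_of_nonneg_right (integral_mono ?_ ?_ fun y => ?_) (Nat.cast_nonneg _)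
  · exact integrable_finsetSum _ fun c _ =>
      integrable_likelihood_mul_sq_sub hpm (abs_posteriorMean_le_sum hC) c
  · exact integrable_finsetSum _ fun c _ => integrable_likelihood_mul_sq_sub hm hB c
  · refine (le_add_of_nonneg_right ?_).trans (sum_likelihood_mul_sq_sub hC y (h y)).ge
    exact mul_nonneg (sq_nonneg _) (evidence_pos hC a x y).le

/-- The estimate that scales the observation by `p`, adds independent Gaussian noise of standard
deviation `q` and applies `h`, averaged over the added noise. -/
noncomputable def degrade (p q : ℝ) (h : (ι → ℝ) → ℝ) (y : ι → ℝ) : ℝ :=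
  ∫ n, h (fun j => p * y j + q * n j) ∂stdNoise ι

lemma measurable_degrade (hm : Measurable h) (p q : ℝ) : Measurable (degrade p q h) := by
  have hjoint : Measurable fun z : (ι → ℝ) × (ι → ℝ) => h fun j => p * z.1 j + q * z.2 j := by
    fun_prop
  exact (hjoint.stronglyMeasurable.integral_prod_right' (ν := stdNoise ι)).measurable

lemma abs_degrade_le (hB : ∀ y, |h y| ≤ B) (p q : ℝ) (y : ι → ℝ) : |degrade p q h y| ≤ B := by
  simpa [degrade] using norm_integral_le_of_norm_le_const (μ := stdNoise ι)
    (f := fun n => h fun j => p * y j + q * n j) (ae_of_all _ fun n => hB _)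

lemma sq_integral_le_integral_sq {Ω : Type*} [MeasurableSpace Ω] {μ : Measure Ω}
    [IsProbabilityMeasure μ] {g : Ω → ℝ} (hg : MemLp g 2 μ) :
    (∫ ω, g ω ∂μ) ^ 2 ≤ ∫ ω, g ω ^ 2 ∂μ :=
  sub_nonneg.1 ((variance_nonneg g μ).trans_eq (variance_eq_sub hg))

lemma sq_sub_degrade_le (hm : Measurable h) (hB : ∀ y, |h y| ≤ B) (p q r : ℝ) (y : ι → ℝ) :
    (r - degrade p q h y) ^ 2 ≤
      ∫ n, (r - h fun j => p * y j + q * n j) ^ 2 ∂stdNoise ι := by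
  have hm' : Measurable fun n : ι → ℝ => h fun j => p * y j + q * n j := by fun_prop
  have hmem : MemLp (fun n => h fun j => p * y j + q * n j) 2 (stdNoise ι) :=
    .of_bound hm'.aestronglyMeasurable B (ae_of_all _ fun n => hB _)
  have hsub : r - degrade p q h y =
      ∫ n, (r - h fun j => p * y j + q * n j) ∂stdNoise ι := by
    rw [integral_sub (integrable_const r) (hmem.integrable one_le_two)]
    simp [degrade]
  rw [hsub]
  exact sq_integral_le_integral_sq ((memLp_const r).sub hmem)

lemma mse_degrade_le {p q : ℝ} (hpq : p ^ 2 + q ^ 2 = 1) (hm : Measurable h)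
    (hB : ∀ y, |h y| ≤ B) (b : ℝ) : mse C b x f (degrade p q h) ≤ mse C (p * b) x f h := by
  refine div_le_div_of_nonneg_right (Finset.sum_le_sum fun c _ => ?_) (Nat.cast_nonneg _)
  have hF : Integrable (fun m => (f c - h fun j => p * b * x c j + m j) ^ 2) (stdNoise ι) :=
    .of_bound (Measurable.aestronglyMeasurable (by fun_prop)) _
      (ae_of_all _ fun m => abs_sq_sub_le (hB _))
  have hdeg := measurable_degrade hm p q
  rw [integral_stdNoise_eq_integral_rotation hpq hF]
  refine integral_mono ?_ ?_ fun n => ?_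
  · exact .of_bound (Measurable.aestronglyMeasurable (by fun_prop)) _
      (ae_of_all _ fun n => abs_sq_sub_le (abs_degrade_le hB p q _))
  · exact ((measurePreserving_stdNoise_rotation hpq).integrable_comp_of_integrable
      hF).integral_prod_left
  · refine (sq_sub_degrade_le hm hB p q (f c) _).trans_eq ?_
    refine integral_congr_ae (ae_of_all _ fun n' => ?_)
    simp only [mul_add, mul_assoc, add_assoc]

lemma mmse_antitone (hC : C.Nonempty) {a b : ℝ} (ha : 0 ≤ a) (hab : a ≤ b) :
    mmse C b x f ≤ mmse C a x f := by
  rcases hab.eq_or_lt with rfl | hlt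
  · exact le_rfl
  have hb : 0 < b := ha.trans_lt hlt
  have hratio : a / b * b = a := div_mul_cancel₀ _ hb.ne'
  have hpq : (a / b) ^ 2 + √(1 - (a / b) ^ 2) ^ 2 = 1 := by
    rw [Real.sq_sqrt, add_sub_cancel]
    exact sub_nonneg.2 (pow_le_one₀ (div_nonneg ha hb.le) ((div_le_one hb).2 hab))
  have hpm := (continuous_posteriorMean (a := a) (x := x) (f := f) hC).measurable
  calc mmse C b x f
      ≤ mse C b x f (degrade (a / b) √(1 - (a / b) ^ 2) (posteriorMean C a x f)) :=
        mmse_le_mse hC (measurable_degrade hpm _ _)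
          (abs_degrade_le (abs_posteriorMean_le_sum hC) _ _)
    _ ≤ mse C (a / b * b) x f (posteriorMean C a x f) :=
        mse_degrade_le hpq hpm (abs_posteriorMean_le_sum hC) b
    _ = mmse C a x f := by rw [hratio, mmse]

end MeanSquaredError

section PosteriorMeanDerivative

variable {ι : Type*} [Fintype ι] {A : Type*} {C : Finset A} {a : ℝ} {x : A → ι → ℝ}

lemma hasDerivAt_likelihood_amplitude (s n : ι → ℝ) (a : ℝ) :
    HasDerivAt (fun a => likelihood a s n)
      (likelihood a s n * ∑ j, (s j * n j - a * s j ^ 2)) a := by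
  refine HasDerivAt.exp (HasDerivAt.fun_sum fun j _ => ?_)
  have hlin := (hasDerivAt_id' a).mul_const (s j)
  refine ((hlin.mul_const (n j)).sub ((hlin.fun_pow 2).div_const 2)).congr_deriv ?_
  push_cast
  ring

lemma hasDerivAt_likelihood_update [DecidableEq ι] (s n : ι → ℝ) (j : ι) (t : ℝ) :
    HasDerivAt (fun t => likelihood a s (Function.update n j t))
      (a * s j * likelihood a s (Function.update n j t)) t := by
  have hexponent : HasDerivAt (fun t => ∑ i, (a * s i * Function.update n j t i -
      (a * s i) ^ 2 / 2)) (∑ i, a * s i * (Pi.single j (1 : ℝ) : ι → ℝ) i) t :=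
    HasDerivAt.fun_sum fun i _ =>
      ((hasDerivAt_pi.1 (hasDerivAt_update n j t) i).const_mul (a * s i)).sub_const _
  refine hexponent.exp.congr_deriv ?_
  rw [← likelihood, mul_comm]
  simp [Pi.single_apply]

lemma hasDerivAt_posteriorMean_update [DecidableEq ι] (hC : C.Nonempty) (f : A → ℝ)
    (n : ι → ℝ) (j : ι) (t : ℝ) :
    HasDerivAt (fun t => posteriorMean C a x f (Function.update n j t))
      (a * (posteriorMean C a x (fun c => f c * x c j) (Function.update n j t) -
        posteriorMean C a x f (Function.update n j t) *
          posteriorMean C a x (fun c => x c j) (Function.update n j t))) t := by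
  have hnum : HasDerivAt (fun t => ∑ c ∈ C, f c * likelihood a (x c) (Function.update n j t))
      (∑ c ∈ C, f c * (a * x c j * likelihood a (x c) (Function.update n j t))) t :=
    HasDerivAt.fun_sum fun c _ => (hasDerivAt_likelihood_update (x c) n j t).const_mul (f c)
  have hden : HasDerivAt (fun t => evidence C a x (Function.update n j t))
      (∑ c ∈ C, a * x c j * likelihood a (x c) (Function.update n j t)) t :=
    HasDerivAt.fun_sum fun c _ => hasDerivAt_likelihood_update (x c) n j t
  have hne := (evidence_pos hC a x (Function.update n j t)).ne'
  refine (hnum.div hden hne).congr_deriv ?_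
  have hnum' : ∑ c ∈ C, f c * (a * x c j * likelihood a (x c) (Function.update n j t)) =
      a * ∑ c ∈ C, f c * x c j * likelihood a (x c) (Function.update n j t) := by
    rw [Finset.mul_sum]; exact Finset.sum_congr rfl fun c _ => by ring
  have hden' : ∑ c ∈ C, a * x c j * likelihood a (x c) (Function.update n j t) =
      a * ∑ c ∈ C, x c j * likelihood a (x c) (Function.update n j t) := by
    rw [Finset.mul_sum]; exact Finset.sum_congr rfl fun c _ => by ring
  simp only [posteriorMean]
  rw [hnum', hden']
  field_simp

lemma integrable_posteriorMean_mul (hC : C.Nonempty) (f g : A → ℝ) :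
    Integrable (fun n => posteriorMean C a x f n * posteriorMean C a x g n) (stdNoise ι) :=
  (integrable_posteriorMean hC).mul_bdd (continuous_posteriorMean hC).aestronglyMeasurable
    (ae_of_all _ (abs_posteriorMean_le_sum hC))

lemma integral_eval_mul_posteriorMean (hC : C.Nonempty) (f : A → ℝ) (j : ι) :
    ∫ n, n j * posteriorMean C a x f n ∂stdNoise ι =
      a * (∫ n, posteriorMean C a x (fun c => f c * x c j) n ∂stdNoise ι -
        ∫ n, posteriorMean C a x f n * posteriorMean C a x (fun c => x c j) n ∂stdNoise ι) := by
  classical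
  have hcont (g : A → ℝ) : Continuous (posteriorMean C a x g) := continuous_posteriorMean hC
  rw [← integral_sub (integrable_posteriorMean hC) (integrable_posteriorMean_mul hC _ _),
    ← integral_const_mul]
  refine integral_eval_mul_stdNoise j (hasDerivAt_posteriorMean_update hC f · j)
    (hcont f).measurable (Continuous.measurable (by fun_prop)) (abs_posteriorMean_le_sum hC)
    (B' := |a| * (∑ c ∈ C, |f c * x c j| + (∑ c ∈ C, |f c|) * ∑ c ∈ C, |x c j|)) fun n => ?_
  rw [abs_mul]
  gcongr
  refine (abs_sub _ _).trans (add_le_add (abs_posteriorMean_le_sum hC n) ?_)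
  rw [abs_mul]
  gcongr
  exacts [abs_posteriorMean_le_sum hC n, abs_posteriorMean_le_sum hC n]

end PosteriorMeanDerivative

section LogEvidence

variable {ι : Type*} [Fintype ι] {A : Type*} {C : Finset A} {x : A → ι → ℝ}

@[fun_prop]
lemma continuous_log_evidence (hC : C.Nonempty) (a : ℝ) (x : A → ι → ℝ) :
    Continuous (fun n => Real.log (evidence C a x n)) :=
  (continuous_evidence a x).log fun n => (evidence_pos hC a x n).ne'

lemma log_evidence_le (hC : C.Nonempty) (a : ℝ) (x : A → ι → ℝ) (n : ι → ℝ) :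
    Real.log (evidence C a x n) ≤ Real.log C.card + ∑ j, n j ^ 2 / 2 := by
  rw [← Real.log_exp (∑ j, n j ^ 2 / 2), ← Real.log_mul
    (by exact_mod_cast hC.card_pos.ne') (Real.exp_pos _).ne']
  refine Real.log_le_log (evidence_pos hC a x n) ?_
  rw [← nsmul_eq_mul]
  refine Finset.sum_le_card_nsmul _ _ _ fun c _ => ?_
  refine Real.exp_le_exp.2 (Finset.sum_le_sum fun j _ => ?_)
  linarith [sq_nonneg (a * x c j - n j)]

lemma le_log_evidence {c : A} (hc : c ∈ C) (a : ℝ) (n : ι → ℝ) :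
    ∑ j, (a * x c j * n j - (a * x c j) ^ 2 / 2) ≤ Real.log (evidence C a x n) :=
  (Real.le_log_iff_exp_le (evidence_pos ⟨c, hc⟩ a x n)).2 (likelihood_le_evidence hc n)

lemma integrable_sum_eval_sq_stdNoise (r : ℝ) :
    Integrable (fun n => r + ∑ j, n j ^ 2 / 2) (stdNoise ι) :=
  (integrable_const r).add (integrable_finsetSum _ fun j _ =>
    (integrable_eval_sq_stdNoise j).div_const 2)

lemma integrable_log_evidence (hC : C.Nonempty) (a : ℝ) (x : A → ι → ℝ) :
    Integrable (fun n => Real.log (evidence C a x n)) (stdNoise ι) := by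
  obtain ⟨c, hc⟩ := hC
  refine integrable_of_le_of_le (continuous_log_evidence ⟨c, hc⟩ a x).aestronglyMeasurable
    (ae_of_all _ fun n => le_log_evidence hc a n)
    (ae_of_all _ fun n => log_evidence_le ⟨c, hc⟩ a x n) ?_ (integrable_sum_eval_sq_stdNoise _)
  exact integrable_finsetSum _ fun j _ =>
    ((integrable_eval_stdNoise j).const_mul _).sub (integrable_const _)

/-- The derivative of the log evidence with respect to the amplitude of the signal. -/
noncomputable def amplitudeScore (C : Finset A) (a : ℝ) (x : A → ι → ℝ) (n : ι → ℝ) : ℝ :=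
  ∑ j, (n j * posteriorMean C a x (fun c => x c j) n -
    a * posteriorMean C a x (fun c => x c j * x c j) n)

lemma hasDerivAt_log_evidence (hC : C.Nonempty) (a : ℝ) (x : A → ι → ℝ) (n : ι → ℝ) :
    HasDerivAt (fun a => Real.log (evidence C a x n)) (amplitudeScore C a x n) a := by
  refine ((HasDerivAt.fun_sum fun c _ => hasDerivAt_likelihood_amplitude (x c) n a).log
    (evidence_pos hC a x n).ne').congr_deriv ?_
  simp only [amplitudeScore, posteriorMean, mul_div_assoc', ← sub_div, ← Finset.sum_div,
    Finset.mul_sum, ← Finset.sum_sub_distrib]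
  rw [Finset.sum_comm, evidence]
  congr 1
  exact Finset.sum_congr rfl fun j _ => Finset.sum_congr rfl fun c _ => by ring

lemma continuous_amplitudeScore (hC : C.Nonempty) (a : ℝ) (x : A → ι → ℝ) :
    Continuous (amplitudeScore C a x) := by
  have hcont (g : A → ℝ) : Continuous (posteriorMean C a x g) := continuous_posteriorMean hC
  unfold amplitudeScore
  fun_prop

lemma abs_amplitudeScore_le (hC : C.Nonempty) {a r : ℝ} (ha : |a| ≤ r) (x : A → ι → ℝ)
    (n : ι → ℝ) : |amplitudeScore C a x n| ≤
      ∑ j, (|n j| * (∑ c ∈ C, |x c j|) + r * ∑ c ∈ C, |x c j * x c j|) := by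
  refine (Finset.abs_sum_le_sum_abs _ _).trans (Finset.sum_le_sum fun j _ => ?_)
  refine (abs_sub _ _).trans (add_le_add ?_ ?_)
  · rw [abs_mul]
    exact mul_le_mul_of_nonneg_left (abs_posteriorMean_le_sum hC n) (abs_nonneg _)
  · rw [abs_mul]
    exact mul_le_mul ha (abs_posteriorMean_le_sum hC n) (abs_nonneg _)
      ((abs_nonneg a).trans ha)

lemma integral_amplitudeScore (hC : C.Nonempty) (a : ℝ) (x : A → ι → ℝ) :
    ∫ n, amplitudeScore C a x n ∂stdNoise ι =
      -a * ∑ j, ∫ n, posteriorMean C a x (fun c => x c j) n ^ 2 ∂stdNoise ι := by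
  have hfst (j : ι) : Integrable (fun n => n j * posteriorMean C a x (fun c => x c j) n)
      (stdNoise ι) :=
    (integrable_eval_stdNoise j).mul_bdd (continuous_posteriorMean hC).aestronglyMeasurable
      (ae_of_all _ (abs_posteriorMean_le_sum hC))
  have hsnd (j : ι) : Integrable (fun n => a * posteriorMean C a x (fun c => x c j * x c j) n)
      (stdNoise ι) := (integrable_posteriorMean hC).const_mul a
  have hdiff (j : ι) : Integrable (fun n => n j * posteriorMean C a x (fun c => x c j) n -
      a * posteriorMean C a x (fun c => x c j * x c j) n) (stdNoise ι) := (hfst j).sub (hsnd j)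
  simp only [amplitudeScore]
  rw [integral_finsetSum _ fun j _ => hdiff j, Finset.mul_sum]
  refine Finset.sum_congr rfl fun j _ => ?_
  rw [integral_sub (hfst j) (hsnd j), integral_eval_mul_posteriorMean hC, integral_const_mul]
  simp only [← sq]
  ring

lemma hasDerivAt_integral_log_evidence (hC : C.Nonempty) (x : A → ι → ℝ) (a : ℝ) :
    HasDerivAt (fun a => ∫ n, Real.log (evidence C a x n) ∂stdNoise ι)
      (-a * ∑ j, ∫ n, posteriorMean C a x (fun c => x c j) n ^ 2 ∂stdNoise ι) a := by
  rw [← integral_amplitudeScore hC]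
  refine (hasDerivAt_integral_of_dominated_loc_of_deriv_le (Metric.ball_mem_nhds a one_pos)
    (.of_forall fun b => (continuous_log_evidence hC b x).aestronglyMeasurable)
    (integrable_log_evidence hC a x) (continuous_amplitudeScore hC a x).aestronglyMeasurable
    (ae_of_all _ fun n b hb => abs_amplitudeScore_le hC (r := |a| + 1) ?_ x n) ?_
    (ae_of_all _ fun n b _ => hasDerivAt_log_evidence hC b x n)).2
  · have hdist : |b - a| < 1 := hb
    linarith [abs_sub_abs_le_abs_sub b a]
  · exact integrable_finsetSum _ fun j _ =>
      ((integrable_eval_stdNoise j).abs.mul_const _).add (integrable_const _)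

lemma tendsto_likelihood_atTop {s : ι → ℝ} (hs : s ≠ 0) (n : ι → ℝ) :
    Tendsto (fun a => likelihood a s n) atTop (𝓝 0) := by
  have henergy : 0 < ∑ j, s j ^ 2 / 2 := by
    obtain ⟨j, hj : s j ≠ 0⟩ := Function.ne_iff.1 hs
    exact Finset.sum_pos' (fun j _ => by positivity) ⟨j, Finset.mem_univ j, by positivity⟩
  have hexponent (a : ℝ) : ∑ j, (a * s j * n j - (a * s j) ^ 2 / 2) =
      a * (∑ j, s j * n j + -(a * ∑ j, s j ^ 2 / 2)) := by
    rw [← sub_eq_add_neg]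
    simp only [Finset.mul_sum, ← Finset.sum_sub_distrib]
    exact Finset.sum_congr rfl fun j _ => by ring
  simp only [likelihood, hexponent]
  exact Real.tendsto_exp_atBot.comp (tendsto_id.atTop_mul_atBot₀
    (tendsto_atBot_add_const_left _ _
      (tendsto_neg_atTop_atBot.comp (tendsto_id.atTop_mul_const henergy))))

lemma tendsto_evidence_atTop {c₀ : A} (hc₀ : c₀ ∈ C) (h0 : x c₀ = 0)
    (hne : ∀ c ∈ C, c ≠ c₀ → x c ≠ 0) (n : ι → ℝ) :
    Tendsto (fun a => evidence C a x n) atTop (𝓝 1) := by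
  classical
  have hterm (c : A) (hc : c ∈ C) :
      Tendsto (fun a => likelihood a (x c) n) atTop (𝓝 (if c = c₀ then 1 else 0)) := by
    split_ifs with hcc₀
    · simp [likelihood, hcc₀, h0]
    · exact tendsto_likelihood_atTop (hne c hc hcc₀) n
  simpa [evidence, hc₀] using tendsto_finsetSum C hterm

lemma tendsto_integral_log_evidence_atTop {c₀ : A} (hc₀ : c₀ ∈ C) (h0 : x c₀ = 0)
    (hne : ∀ c ∈ C, c ≠ c₀ → x c ≠ 0) :
    Tendsto (fun a => ∫ n, Real.log (evidence C a x n) ∂stdNoise ι) atTop (𝓝 0) := by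
  have hC : C.Nonempty := ⟨c₀, hc₀⟩
  rw [← integral_zero (ι → ℝ) ℝ (μ := stdNoise ι)]
  refine tendsto_integral_filter_of_dominated_convergence
    (fun n => Real.log C.card + ∑ j, n j ^ 2 / 2)
    (.of_forall fun a => (continuous_log_evidence hC a x).aestronglyMeasurable)
    (.of_forall fun a => ae_of_all _ fun n => ?_) (integrable_sum_eval_sq_stdNoise _)
    (ae_of_all _ fun n => ?_)
  · have hnonneg : 0 ≤ Real.log (evidence C a x n) := by
      simpa [h0] using le_log_evidence (x := x) hc₀ a n
    rw [Real.norm_eq_abs, abs_of_nonneg hnonneg]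
    exact log_evidence_le hC a x n
  · simpa using (tendsto_evidence_atTop hc₀ h0 hne n).log one_ne_zero

end LogEvidence

section MutualInformation

variable {ι : Type*} [Fintype ι] {A : Type*} {C : Finset A} {x : A → ι → ℝ}

/-- The equivocation `H(c | a x c + n)` in nats, for `c` uniform on `C` and standard Gaussian
noise `n`. -/
noncomputable def equivocation (C : Finset A) (x : A → ι → ℝ) (a : ℝ) : ℝ :=
  (∑ c₀ ∈ C, ∫ n, Real.log (evidence C a (fun c => x c - x c₀) n) ∂stdNoise ι) / C.card

lemma hasDerivAt_equivocation (hC : C.Nonempty) (x : A → ι → ℝ) (a : ℝ) :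
    HasDerivAt (equivocation C x) (-a * ∑ j, mmse C a x fun c => x c j) a := by
  refine ((HasDerivAt.fun_sum fun c₀ _ => hasDerivAt_integral_log_evidence hC
    (fun c => x c - x c₀) a).div_const (C.card : ℝ)).congr_deriv ?_
  simp only [mmse, mse, posteriorMean_shift, Pi.sub_apply, posteriorMean_sub_const hC]
  rw [← Finset.mul_sum, mul_div_assoc, ← Finset.sum_div, Finset.sum_comm]
  simp only [sub_sq_comm]

lemma equivocation_zero (hC : C.Nonempty) (x : A → ι → ℝ) :
    equivocation C x 0 = Real.log C.card := by
  have hcard : (C.card : ℝ) ≠ 0 := by exact_mod_cast hC.card_pos.ne'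
  simp [equivocation, evidence, likelihood, hcard]

lemma tendsto_equivocation_atTop (hx : Set.InjOn x C) :
    Tendsto (equivocation C x) atTop (𝓝 0) := by
  have hterm (c₀ : A) (hc₀ : c₀ ∈ C) : Tendsto (fun a => ∫ n, Real.log
      (evidence C a (fun c => x c - x c₀) n) ∂stdNoise ι) atTop (𝓝 0) :=
    tendsto_integral_log_evidence_atTop hc₀ (sub_self _) fun c hc hne h =>
      hne (hx hc hc₀ (sub_eq_zero.1 h))
  unfold equivocation
  simpa using (tendsto_finsetSum C hterm).div_const (C.card : ℝ)

lemma hasDerivAt_equivocation_sqrt (hC : C.Nonempty) (x : A → ι → ℝ) {γ : ℝ} (hγ : 0 < γ) :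
    HasDerivAt (fun γ => equivocation C x √γ) (-((∑ j, mmse C √γ x fun c => x c j) / 2)) γ := by
  have hsqrt : √γ ≠ 0 := (Real.sqrt_pos.2 hγ).ne'
  refine ((hasDerivAt_equivocation hC x √γ).comp γ (Real.hasDerivAt_sqrt hγ.ne')).congr_deriv ?_
  field_simp

lemma integrableOn_sum_mmse_and_integral_eq (hC : C.Nonempty) (hx : Set.InjOn x C) :
    IntegrableOn (fun γ : ℝ => ∑ j, mmse C √γ x fun c => x c j) (Ioi 0) ∧
      ∫ γ in Ioi (0 : ℝ), ∑ j, mmse C √γ x (fun c => x c j) = 2 * Real.log C.card := by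
  have hcont : Continuous fun γ => equivocation C x √γ :=
    (continuous_iff_continuousAt.2 fun a => (hasDerivAt_equivocation hC x a).continuousAt).comp
      Real.continuous_sqrt
  have hderiv (γ : ℝ) (hγ : γ ∈ Ioi (0 : ℝ)) := hasDerivAt_equivocation_sqrt hC x hγ
  have hnonpos (γ : ℝ) (_ : γ ∈ Ioi (0 : ℝ)) : -((∑ j, mmse C √γ x fun c => x c j) / 2) ≤ 0 :=
    neg_nonpos.2 (div_nonneg (Finset.sum_nonneg fun j _ => mse_nonneg) zero_le_two)
  have hlim := (tendsto_equivocation_atTop hx).comp Real.tendsto_sqrt_atTop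
  have hint := integrableOn_Ioi_deriv_of_nonpos hcont.continuousWithinAt hderiv hnonpos hlim
  have hval := integral_Ioi_of_hasDerivAt_of_nonpos hcont.continuousWithinAt hderiv hnonpos hlim
  refine ⟨(hint.const_mul (-2)).congr (ae_of_all _ fun γ => by ring), ?_⟩
  rw [integral_neg, integral_div, Real.sqrt_zero, equivocation_zero hC] at hval
  linarith

end MutualInformation

section UniformMessage

lemma measurableEmbedding_prodMk {A E : Type*} [MeasurableSpace A] [MeasurableSingletonClass A]
    [MeasurableSpace E] (c : A) : MeasurableEmbedding (Prod.mk c : E → A × E) :=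
  MeasurableEmbedding.id.prodMk_left c

variable {A : Type*} [MeasurableSpace A] [MeasurableSingletonClass A]
  {E : Type*} [MeasurableSpace E] {ν : Measure E} {C : Finset A}

lemma uniformOn_finset_eq (C : Finset A) :
    uniformOn (C : Set A) = (C.card : ℝ≥0∞)⁻¹ • ∑ c ∈ C, Measure.dirac c := by
  classical
  ext s hs
  have hfilter : (C : Set A) ∩ s = C.filter (· ∈ s) := by ext; simp
  rw [uniformOn, cond_apply C.measurableSet, hfilter, Measure.count_apply_finset,
    Measure.count_apply_finset, Finset.card_filter]
  simp [hs, indicator_apply]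

lemma uniformOn_prod_eq (C : Finset A) (ν : Measure E) [SFinite ν] :
    (uniformOn (C : Set A)).prod ν = (C.card : ℝ≥0∞)⁻¹ • ∑ c ∈ C, ν.map (Prod.mk c) := by
  rw [uniformOn_finset_eq, Measure.prod_smul_left, ← Measure.sum_coe_finset,
    Measure.prod_sum_left]
  simp only [Measure.dirac_prod, Measure.sum_coe_finset C fun c => ν.map (Prod.mk c)]

lemma integral_uniformOn_prod [SFinite ν] {F : A × E → ℝ}
    (hF : ∀ c ∈ C, Integrable (fun e => F (c, e)) ν) :
    ∫ ω, F ω ∂(uniformOn (C : Set A)).prod ν = (∑ c ∈ C, ∫ e, F (c, e) ∂ν) / C.card := by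
  rw [uniformOn_prod_eq, integral_smul_measure, integral_finsetSum_measure]
  · simp only [(measurableEmbedding_prodMk _).integral_map]
    simp [div_eq_inv_mul]
  · exact fun c hc => (measurableEmbedding_prodMk c).integrable_map_iff.2 (hF c hc)

lemma integrable_uniformOn_prod [SFinite ν] (hC : C.Nonempty) {F : A × E → ℝ}
    (hF : ∀ c ∈ C, Integrable (fun e => F (c, e)) ν) :
    Integrable F ((uniformOn (C : Set A)).prod ν) := by
  rw [uniformOn_prod_eq]
  refine Integrable.smul_measure ?_ (by simpa using hC.ne_empty)
  exact integrable_finsetSum_measure.2 fun c hc =>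
    (measurableEmbedding_prodMk c).integrable_map_iff.2 (hF c hc)

variable [IsFiniteMeasure ν] {E' : Type*} [MeasurableSpace E'] {ν' : Measure E'} {O : A × E → E'}
  {l : A → E' → ℝ}

lemma integral_uniformOn_prod_comp (hO : Measurable O) (hl : ∀ c, Measurable (l c))
    (hl0 : ∀ c y, 0 ≤ l c y)
    (hmap : ∀ c, ν.map (fun e => O (c, e)) = ν'.withDensity fun y => ENNReal.ofReal (l c y))
    {F : A → E' → ℝ} (hF : ∀ c, Measurable (F c)) {B : ℝ} (hB : ∀ c ∈ C, ∀ y, |F c y| ≤ B) :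
    ∫ ω, F ω.1 (O ω) ∂(uniformOn (C : Set A)).prod ν =
      (∫ y, ∑ c ∈ C, l c y * F c y ∂ν') / C.card := by
  have hOc (c : A) : Measurable fun e => O (c, e) := hO.comp measurable_prodMk_left
  rw [integral_uniformOn_prod (F := fun ω => F ω.1 (O ω)) fun c hc =>
      .of_bound ((hF c).comp (hOc c)).aestronglyMeasurable B (ae_of_all _ fun e => hB c hc _),
    integral_finsetSum _ fun c hc =>
      (integrable_of_map_eq_withDensity (hl c) (hl0 c) (hmap c)).mul_bdd (c := B)
        (hF c).aestronglyMeasurable (ae_of_all _ (hB c hc))]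
  congr 1
  exact Finset.sum_congr rfl fun c _ => integral_comp_eq_integral_mul_of_map_eq_withDensity
    (hOc c) (hl c) (hl0 c) (hmap c) (hF c)

lemma condExp_uniformOn_prod (hC : C.Nonempty) (hO : Measurable O)
    (hl : ∀ c, Measurable (l c)) (hpos : ∀ c y, 0 < l c y)
    (hmap : ∀ c, ν.map (fun e => O (c, e)) = ν'.withDensity fun y => ENNReal.ofReal (l c y))
    (f : A → ℝ) :
    ((uniformOn (C : Set A)).prod ν)[fun ω => f ω.1 | MeasurableSpace.comap O inferInstance]
      =ᵐ[(uniformOn (C : Set A)).prod ν]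
      fun ω => (∑ c ∈ C, f c * l c (O ω)) / ∑ c ∈ C, l c (O ω) := by
  have := isProbabilityMeasure_uniformOn C.finite_toSet hC
  set g : E' → ℝ := fun y => (∑ c ∈ C, f c * l c y) / ∑ c ∈ C, l c y
  have hg : Measurable g := by fun_prop
  have hf (c : A) (hc : c ∈ C) : |f c| ≤ ∑ c ∈ C, |f c| :=
    Finset.single_le_sum (f := fun c => |f c|) (fun _ _ => abs_nonneg _) hc
  have hgB (y : E') : |g y| ≤ ∑ c ∈ C, |f c| := abs_sum_mul_div_sum_le hC (hpos · y) hf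
  refine (ae_eq_condExp_of_forall_setIntegral_eq hO.comap_le
    (integrable_uniformOn_prod hC fun c _ => integrable_const (f c))
    (fun s _ _ => (Integrable.of_bound (hg.comp hO).aestronglyMeasurable _
      (ae_of_all _ fun ω => hgB _)).integrableOn) ?_
    ((hg.comp (comap_measurable O)).stronglyMeasurable).aestronglyMeasurable).symm
  rintro s ⟨S, hS, rfl⟩ _
  have hbdd {u : ℝ} (hu : |u| ≤ ∑ c ∈ C, |f c|) (y : E') :
      |S.indicator (fun _ => u) y| ≤ ∑ c ∈ C, |f c| :=
    (norm_indicator_le_norm_self (fun _ => u) y).trans hu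
  have hchange {F : A → E' → ℝ} := integral_uniformOn_prod_comp (C := C) (ν := ν) (F := F) hO hl
    (fun c y => (hpos c y).le) hmap
  have hestimate := hchange (F := fun _ => S.indicator g) (fun _ => hg.indicator hS)
    fun c _ y => (norm_indicator_le_norm_self g y).trans (hgB y)
  have hmessage := hchange (F := fun c => S.indicator fun _ => f c)
    (fun _ => measurable_const.indicator hS) fun c hc => hbdd (hf c hc)
  rw [← integral_indicator (hO hS), ← integral_indicator (hO hS)]
  refine (hestimate.trans ?_).trans hmessage.symm
  simp only [g, sum_mul_indicator_weightedMean hC hpos f S]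

end UniformMessage

section SingleBit

@[fun_prop]
lemma continuous_tanh : Continuous Real.tanh := by
  simp only [funext Real.tanh_eq_sinh_div_cosh]
  exact Real.continuous_sinh.div Real.continuous_cosh fun x => (Real.cosh_pos x).ne'

lemma bpsk_sq (b : Bool) : bpsk b ^ 2 = 1 := by cases b <;> simp [bpsk]

lemma abs_bpsk (b : Bool) : |bpsk b| = 1 := by cases b <;> simp [bpsk]

lemma bpsk_injective : Function.Injective bpsk := by
  intro b b'
  cases b <;> cases b' <;> norm_num [bpsk]

lemma abs_sq_bpsk_sub_tanh_le (b : Bool) (u : ℝ) : |(bpsk b - Real.tanh u) ^ 2| ≤ (1 + 1) ^ 2 := by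
  simpa only [abs_bpsk] using abs_sq_sub_le (r := bpsk b) (Real.abs_tanh_lt_one u).le

lemma exp_mul_bpsk_sub (a : ℝ) (b : Bool) (y : ℝ) :
    Real.exp (a * bpsk b * y - (a * bpsk b) ^ 2 / 2) =
      Real.exp (-a ^ 2 / 2) * Real.exp (bpsk b * (a * y)) := by
  rw [← Real.exp_add, mul_pow, bpsk_sq]
  ring_nf

lemma sum_bpsk_mul_exp_div_sum_exp (a y : ℝ) :
    (∑ b, bpsk b * Real.exp (a * bpsk b * y - (a * bpsk b) ^ 2 / 2)) /
      ∑ b, Real.exp (a * bpsk b * y - (a * bpsk b) ^ 2 / 2) = Real.tanh (a * y) := by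
  simp only [exp_mul_bpsk_sub, mul_left_comm (bpsk _), ← Finset.mul_sum]
  rw [mul_div_mul_left _ _ (Real.exp_pos _).ne', Real.tanh_eq]
  simp [bpsk, sub_eq_add_neg]

lemma sum_exp_mul_sq_bpsk_sub_tanh (u : ℝ) :
    ∑ b, Real.exp (bpsk b * u) * (bpsk b - Real.tanh u) ^ 2 = 2 * (Real.cosh u)⁻¹ := by
  simp only [Fintype.sum_bool, bpsk, if_true, Bool.false_eq_true, if_false, one_mul, neg_one_mul,
    Real.tanh_eq, Real.cosh_eq, Real.exp_neg]
  field_simp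
  ring

lemma integral_bitLaw {F : Bool × ℝ → ℝ}
    (hF : ∀ b, Integrable (fun n => F (b, n)) (gaussianReal 0 1)) :
    ∫ ω, F ω ∂bitLaw =
      (∫ n, F (true, n) ∂gaussianReal 0 1 + ∫ n, F (false, n) ∂gaussianReal 0 1) / 2 := by
  rw [bitLaw, ← Finset.coe_univ, integral_uniformOn_prod fun b _ => hF b]
  simp

@[fun_prop]
lemma measurable_bitOutput (γ : ℝ≥0) : Measurable (bitOutput γ) := by
  unfold bitOutput
  have := measurable_of_countable bpsk
  fun_prop

lemma bitEstimate_ae_eq_tanh (γ : ℝ≥0) :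
    bitEstimate γ =ᵐ[bitLaw] fun ω => Real.tanh (√γ * bitOutput γ ω) := by
  have hbayes := condExp_uniformOn_prod (C := Finset.univ) (ν := gaussianReal 0 1)
    Finset.univ_nonempty (measurable_bitOutput γ)
    (l := fun b y => Real.exp (√γ * bpsk b * y - (√γ * bpsk b) ^ 2 / 2))
    (fun b => by fun_prop) (fun b y => Real.exp_pos _)
    (fun b => gaussianReal_map_const_add_eq_withDensity (√γ * bpsk b)) bpsk
  simp only [Finset.coe_univ, sum_bpsk_mul_exp_div_sum_exp] at hbayes
  exact hbayes

lemma phi_coe (γ : ℝ≥0) :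
    phi γ = ∫ ω, (bpsk ω.1 - Real.tanh (√γ * bitOutput γ ω)) ^ 2 ∂bitLaw := by
  rw [phi, if_neg ENNReal.coe_ne_top, ENNReal.toNNReal_coe]
  refine integral_congr_ae ?_
  filter_upwards [bitEstimate_ae_eq_tanh γ] with ω hω
  rw [hω]

lemma integral_bit_error (γ : ℝ≥0) (b : Bool) :
    ∫ n, (bpsk b - Real.tanh (√γ * (√γ * bpsk b + n))) ^ 2 ∂gaussianReal 0 1 =
      ∫ n, (1 - Real.tanh (√γ * (√γ + n))) ^ 2 ∂gaussianReal 0 1 := by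
  cases b
  · have hneg : (gaussianReal 0 1).map (fun x => -x) = gaussianReal 0 1 := by
      rw [gaussianReal_map_neg, neg_zero]
    rw [← hneg, integral_map (by fun_prop) (by fun_prop), hneg]
    congr 1
    ext n
    rw [show √(γ : ℝ) * (√γ * bpsk false + -n) = -(√γ * (√γ + n)) by simp [bpsk]; ring,
      Real.tanh_neg]
    simp only [bpsk, Bool.false_eq_true, if_false]
    ring
  · simp [bpsk]

lemma integrable_bit_error (γ : ℝ≥0) (b : Bool) :
    Integrable (fun n => (bpsk b - Real.tanh (√γ * (√γ * bpsk b + n))) ^ 2)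
      (gaussianReal 0 1) :=
  .of_bound (by fun_prop) _ (ae_of_all _ fun _ => abs_sq_bpsk_sub_tanh_le b _)

lemma integral_bit_error_eq_phi (γ : ℝ≥0) (b : Bool) :
    ∫ n, (bpsk b - Real.tanh (√γ * (√γ * bpsk b + n))) ^ 2 ∂gaussianReal 0 1 = phi γ := by
  rw [phi_coe, integral_bitLaw (integrable_bit_error γ)]
  simp only [bitOutput, integral_bit_error, add_self_div_two]

lemma likelihood_bpsk (a : ℝ) (b : Bool) (y : Unit → ℝ) :
    likelihood a (fun _ => bpsk b) y =
      Real.exp (a * bpsk b * y () - (a * bpsk b) ^ 2 / 2) := by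
  simp [likelihood]

lemma posteriorMean_bpsk (a : ℝ) (y : Unit → ℝ) :
    posteriorMean Finset.univ a (fun b _ => bpsk b) bpsk y = Real.tanh (a * y ()) := by
  simp only [posteriorMean, evidence, likelihood_bpsk, sum_bpsk_mul_exp_div_sum_exp]

lemma phi_eq_mmse (γ : ℝ≥0) :
    phi γ = mmse Finset.univ √(γ : ℝ) (fun b (_ : Unit) => bpsk b) bpsk := by
  have herror (b : Bool) : ∫ n : Unit → ℝ,
      (bpsk b - Real.tanh (√γ * (√γ * bpsk b + n ()))) ^ 2 ∂stdNoise Unit = phi γ := by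
    rw [← integral_bit_error_eq_phi γ b]
    exact integral_comp_eval (μ := fun _ : Unit => gaussianReal 0 1)
      (f := fun t => (bpsk b - Real.tanh (√γ * (√γ * bpsk b + t))) ^ 2) (by fun_prop)
  simp only [mmse, mse, posteriorMean_bpsk, herror]
  simp

lemma integrable_inv_cosh (a : ℝ) :
    Integrable (fun t => (Real.cosh (a * t))⁻¹) (gaussianReal 0 1) := by
  refine .of_bound (by fun_prop) 1 (ae_of_all _ fun t => ?_)
  rw [Real.norm_of_nonneg (inv_pos.2 (Real.cosh_pos _)).le]
  exact inv_le_one_of_one_le₀ (Real.one_le_cosh _)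

lemma integral_inv_cosh_pos (a : ℝ) : 0 < ∫ t, (Real.cosh (a * t))⁻¹ ∂gaussianReal 0 1 := by
  rw [integral_pos_iff_support_of_nonneg (fun t => (inv_pos.2 (Real.cosh_pos _)).le)
    (integrable_inv_cosh a)]
  have hsupport : Function.support (fun t => (Real.cosh (a * t))⁻¹) = univ := by
    ext t; simpa using (Real.cosh_pos _).ne'
  simp [hsupport]

lemma phi_eq_exp_mul (γ : ℝ≥0) :
    phi γ = Real.exp (-γ / 2) * ∫ t, (Real.cosh (√γ * t))⁻¹ ∂gaussianReal 0 1 := by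
  have herror (y : Unit → ℝ) : ∑ b, likelihood √(γ : ℝ) (fun _ => bpsk b) y *
      (bpsk b - posteriorMean Finset.univ √(γ : ℝ) (fun b _ => bpsk b) bpsk y) ^ 2 =
      2 * (Real.exp (-γ / 2) * (Real.cosh (√γ * y ()))⁻¹) := by
    simp only [likelihood_bpsk, posteriorMean_bpsk, exp_mul_bpsk_sub, mul_assoc (Real.exp _),
      ← Finset.mul_sum, sum_exp_mul_sq_bpsk_sub_tanh, Real.sq_sqrt γ.coe_nonneg]
    exact mul_left_comm _ (2 : ℝ) _
  rw [phi_eq_mmse, mmse, mse_eq_integral_likelihood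
    (continuous_posteriorMean Finset.univ_nonempty).measurable
    (abs_posteriorMean_le_sum Finset.univ_nonempty)]
  simp only [herror, integral_const_mul]
  rw [stdNoise, integral_comp_eval (μ := fun _ : Unit => gaussianReal 0 1)
      (f := fun t => (Real.cosh (√γ * t))⁻¹) (integrable_inv_cosh _).1]
  simp

lemma phi_coe_pos (γ : ℝ≥0) : 0 < phi γ := by
  rw [phi_eq_exp_mul]
  exact mul_pos (Real.exp_pos _) (integral_inv_cosh_pos _)

lemma phi_top : phi ⊤ = 0 := by simp [phi]

lemma phi_strictAnti : StrictAnti phi := by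
  intro s t hst
  lift s to ℝ≥0 using hst.ne_top
  induction t with
  | top => rw [phi_top]; exact phi_coe_pos s
  | coe t =>
    have hst' : (s : ℝ) < t := by exact_mod_cast hst
    rw [phi_eq_exp_mul, phi_eq_exp_mul]
    refine mul_lt_mul (Real.exp_lt_exp.2 (by linarith)) ?_ (integral_inv_cosh_pos _)
      (Real.exp_pos _).le
    refine integral_mono (integrable_inv_cosh _) (integrable_inv_cosh _) fun y => ?_
    refine inv_anti₀ (Real.cosh_pos _) (Real.cosh_le_cosh.2 ?_)
    rw [abs_mul, abs_mul, abs_of_nonneg (Real.sqrt_nonneg _), abs_of_nonneg (Real.sqrt_nonneg _)]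
    gcongr

lemma phi_nonneg (γ : ℝ≥0∞) : 0 ≤ phi γ := by
  rw [← phi_top]
  exact phi_strictAnti.antitone le_top

lemma integrableOn_phi_and_integral_eq :
    IntegrableOn (fun γ : ℝ => phi (ENNReal.ofReal γ)) (Ioi 0) ∧
      ∫ γ in Ioi (0 : ℝ), phi (ENNReal.ofReal γ) = Real.log 4 := by
  have hinj : InjOn (fun b (_ : Unit) => bpsk b) (Finset.univ : Finset Bool) :=
    fun b _ b' _ hb => bpsk_injective (congrFun hb ())
  have hphi (γ : ℝ) (hγ : γ ∈ Ioi (0 : ℝ)) :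
      ∑ _j : Unit, mmse Finset.univ √γ (fun b (_ : Unit) => bpsk b) (fun b => bpsk b) =
        phi (ENNReal.ofReal γ) := by
    rw [ENNReal.ofReal, phi_eq_mmse, Real.coe_toNNReal γ (le_of_lt hγ)]
    simp
  obtain ⟨hint, hval⟩ := integrableOn_sum_mmse_and_integral_eq
    (C := (Finset.univ : Finset Bool)) Finset.univ_nonempty hinj
  refine ⟨hint.congr_fun hphi measurableSet_Ioi, ?_⟩
  rw [← setIntegral_congr_fun measurableSet_Ioi hphi, hval, show (4 : ℝ) = 2 ^ 2 by norm_num,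
    Real.log_pow]
  simp

end SingleBit

section LogLikelihoodRatio

/-- The mean of an antipodal bit whose log likelihood ratio is `l`, that is `tanh (l / 2)` extended
continuously to `l = ±∞`. -/
noncomputable def llrMean (l : EReal) : ℝ := 1 - 2 * (1 + EReal.exp l)⁻¹.toReal

lemma inv_one_add_le_one (u : ℝ≥0∞) : (1 + u)⁻¹ ≤ 1 := ENNReal.inv_le_one.2 le_self_add

@[fun_prop]
lemma continuous_llrMean : Continuous llrMean := by
  unfold llrMean
  have hinv : Continuous fun l => (1 + EReal.exp l)⁻¹ :=
    continuous_inv.comp (continuous_const.add ENNReal.continuous_exp)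
  exact continuous_const.sub (continuous_const.mul (ENNReal.continuousOn_toReal.comp_continuous
    hinv fun l => ((inv_one_add_le_one _).trans_lt ENNReal.one_lt_top).ne))

lemma abs_llrMean_le_one (l : EReal) : |llrMean l| ≤ 1 := by
  have hle : (1 + EReal.exp l)⁻¹.toReal ≤ 1 :=
    ENNReal.toReal_le_of_le_ofReal zero_le_one (by simp)
  have hnonneg : 0 ≤ (1 + EReal.exp l)⁻¹.toReal := ENNReal.toReal_nonneg
  rw [abs_le, llrMean]
  constructor <;> linarith

lemma llrMean_coe_two_mul (u : ℝ) : llrMean ((2 * u : ℝ) : EReal) = Real.tanh u := by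
  rw [llrMean, EReal.exp_coe, ← ENNReal.ofReal_one,
    ← ENNReal.ofReal_add zero_le_one (Real.exp_pos _).le, ENNReal.toReal_inv,
    ENNReal.toReal_ofReal (by positivity), Real.tanh_eq, two_mul u, Real.exp_add, Real.exp_neg]
  field_simp
  ring

lemma llrMean_top : llrMean ⊤ = 1 := by simp [llrMean]

lemma llrMean_bot : llrMean ⊥ = -1 := by norm_num [llrMean]

lemma llrMean_log_sub_log_add {p q : ℝ} (hp : 0 ≤ p) (hq : 0 ≤ q) (hpq : p + q = 1) (u : ℝ) :
    llrMean (ENNReal.log (ENNReal.ofReal p) - ENNReal.log (ENNReal.ofReal q) + (2 * u : ℝ)) =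
      (p * Real.exp u - q * Real.exp (-u)) / (p * Real.exp u + q * Real.exp (-u)) := by
  rw [llrMean, sub_eq_add_neg (ENNReal.log _), EReal.exp_add, EReal.exp_add, EReal.exp_neg,
    ENNReal.exp_log, ENNReal.exp_log, EReal.exp_coe]
  rcases hq.eq_or_lt with rfl | hq
  · obtain rfl : p = 1 := by linarith
    simp [ENNReal.top_mul, Real.exp_pos, (Real.exp_pos u).ne']
  · rw [← ENNReal.ofReal_inv_of_pos hq, ← ENNReal.ofReal_mul hp,
      ← ENNReal.ofReal_mul (by positivity), ← ENNReal.ofReal_one,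
      ← ENNReal.ofReal_add zero_le_one (by positivity), ENNReal.toReal_inv,
      ENNReal.toReal_ofReal (by positivity), two_mul u, Real.exp_add, Real.exp_neg]
    field_simp
    ring

lemma abs_sq_bpsk_sub_llrMean_le (b : Bool) (l : EReal) :
    |(bpsk b - llrMean l) ^ 2| ≤ (1 + 1) ^ 2 := by
  simpa only [abs_bpsk] using abs_sq_sub_le (r := bpsk b) (abs_llrMean_le_one l)

/-- The squared error of the estimate of a bit from its log likelihood ratio. -/
noncomputable def llrError : (Bool × EReal) →ᵇ ℝ :=
  .ofNormedAddCommGroup (fun z => (bpsk z.1 - llrMean z.2) ^ 2)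
    (((continuous_of_discreteTopology (f := bpsk)).comp continuous_fst |>.sub
      (continuous_llrMean.comp continuous_snd)).pow 2) ((1 + 1) ^ 2)
    fun z => abs_sq_bpsk_sub_llrMean_le z.1 z.2

lemma llrError_apply (b : Bool) (l : EReal) : llrError (b, l) = (bpsk b - llrMean l) ^ 2 := rfl

/-- The squared error of the estimate of a bit `b` from its log likelihood ratio `l` and the
observation `√γ x + r` of its symbol `x`, which adds `2 √γ (√γ x + r)` to `l`. -/
noncomputable def combinedError (γ : ℝ≥0) (b : Bool) (l : EReal) (r : ℝ) : ℝ :=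
  (bpsk b - llrMean (l + (2 * (√(γ : ℝ) * (√(γ : ℝ) * bpsk b + r)) : ℝ))) ^ 2

lemma continuous_combinedError (γ : ℝ≥0) (b : Bool) :
    Continuous (Function.uncurry (combinedError γ b)) := by
  have hadd : Continuous fun p : EReal × ℝ => p.1 + (p.2 : EReal) :=
    continuous_iff_continuousAt.2 fun p =>
      ContinuousAt.comp (f := fun p : EReal × ℝ => (p.1, (p.2 : EReal)))
        (EReal.continuousAt_add (.inr (EReal.coe_ne_bot _)) (.inr (EReal.coe_ne_top _)))
        (continuous_fst.prodMk (continuous_coe_real_ereal.comp continuous_snd)).continuousAt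
  have hshift : Continuous fun p : EReal × ℝ =>
      (p.1, 2 * (√(γ : ℝ) * (√(γ : ℝ) * bpsk b + p.2))) := by fun_prop
  exact (continuous_const.sub (continuous_llrMean.comp (hadd.comp hshift))).pow 2

lemma abs_combinedError_le (γ : ℝ≥0) (b : Bool) (l : EReal) (r : ℝ) :
    |combinedError γ b l r| ≤ (1 + 1) ^ 2 :=
  abs_sq_bpsk_sub_llrMean_le b _

lemma continuous_integral_combinedError (γ : ℝ≥0) (b : Bool) :
    Continuous fun l => ∫ r, combinedError γ b l r ∂gaussianReal 0 1 :=
  continuous_of_dominated (bound := fun _ => (1 + 1) ^ 2)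
    (fun l => ((continuous_combinedError γ b).uncurry_left l).aestronglyMeasurable)
    (fun l => ae_of_all _ (abs_combinedError_le γ b l)) (integrable_const _)
    (ae_of_all _ fun r => (continuous_combinedError γ b).uncurry_right r)

/-- The mean squared error of the estimate of a bit from its log likelihood ratio and an
independent observation of it over a Gaussian channel of signal to noise ratio `γ`. -/
noncomputable def llrErrorWith (γ : ℝ≥0) : (Bool × EReal) →ᵇ ℝ :=
  .ofNormedAddCommGroup (fun z => ∫ r, combinedError γ z.1 z.2 r ∂gaussianReal 0 1)
    (continuous_prod_of_discrete_left.2 (continuous_integral_combinedError γ)) ((1 + 1) ^ 2)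
    fun z => by
      simpa using norm_integral_le_of_norm_le_const (μ := gaussianReal 0 1)
        (f := combinedError γ z.1 z.2)
        (ae_of_all _ (abs_combinedError_le γ z.1 z.2))

lemma llrErrorWith_apply (γ : ℝ≥0) (b : Bool) (l : EReal) :
    llrErrorWith γ (b, l) = ∫ r, combinedError γ b l r ∂gaussianReal 0 1 := rfl

lemma gaussLLR_coe (γ : ℝ≥0) (ω : Bool × ℝ) :
    gaussLLR γ ω = (2 * (√(γ : ℝ) * bitOutput γ ω) : ℝ) := by
  simp only [gaussLLR, if_neg ENNReal.coe_ne_top, ENNReal.toNNReal_coe, mul_assoc]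

lemma llrMean_gaussLLR_top (ω : Bool × ℝ) : llrMean (gaussLLR ⊤ ω) = bpsk ω.1 := by
  cases h : ω.1 <;> simp [gaussLLR, h, llrMean_top, llrMean_bot, bpsk]

lemma gaussLLR_top_add_coe (ω : Bool × ℝ) (u : ℝ) : gaussLLR ⊤ ω + u = gaussLLR ⊤ ω := by
  cases h : ω.1 <;> simp [gaussLLR, h]

lemma integral_llrError_gaussLLR (γ : ℝ≥0∞) :
    ∫ ω, llrError (ω.1, gaussLLR γ ω) ∂bitLaw = phi γ := by
  induction γ with
  | top => simp [llrError_apply, llrMean_gaussLLR_top, phi_top]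
  | coe γ => simp only [llrError_apply, gaussLLR_coe, llrMean_coe_two_mul, phi_coe]

lemma exists_polar_sqrt (s t : ℝ≥0) : ∃ p q : ℝ, p ^ 2 + q ^ 2 = 1 ∧
    √((s + t : ℝ≥0) : ℝ) * p = √(s : ℝ) ∧ √((s + t : ℝ≥0) : ℝ) * q = √(t : ℝ) := by
  set z : ℂ := ⟨√(s : ℝ), √(t : ℝ)⟩
  have hnorm : √((s + t : ℝ≥0) : ℝ) = ‖z‖ := by
    rw [Complex.norm_eq_sqrt_sq_add_sq, Real.sq_sqrt s.coe_nonneg, Real.sq_sqrt t.coe_nonneg,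
      NNReal.coe_add]
  rw [hnorm]
  exact ⟨_, _, Real.cos_sq_add_sin_sq z.arg, Complex.norm_mul_cos_arg z,
    Complex.norm_mul_sin_arg z⟩

-- Two independent observations of a bit are rotated onto one observation of signal to noise ratio
-- `s + γ` and pure noise.
lemma integral_integral_bit_error_eq_phi (s γ : ℝ≥0) (b : Bool) :
    ∫ n, ∫ r, (bpsk b - Real.tanh (√(s : ℝ) * (√(s : ℝ) * bpsk b + n) +
      √(γ : ℝ) * (√(γ : ℝ) * bpsk b + r))) ^ 2 ∂gaussianReal 0 1 ∂gaussianReal 0 1 =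
      phi ↑(s + γ) := by
  obtain ⟨p, q, hpq, hp, hq⟩ := exists_polar_sqrt s γ
  rw [← integral_bit_error_eq_phi (s + γ) b]
  conv_rhs => rw [← gaussianReal_prod_map_rotation hpq]
  rw [integral_map (by fun_prop) (by fun_prop), integral_prod]
  · congr! 7 with n r
    rw [← hp, ← hq]
    linear_combination (√((s + γ : ℝ≥0) : ℝ) ^ 2 * bpsk b) * hpq
  · exact .of_bound (by fun_prop) _ (ae_of_all _ fun z => abs_sq_bpsk_sub_tanh_le b _)

lemma integral_llrErrorWith_gaussLLR (γ : ℝ≥0) (s : ℝ≥0∞) :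
    ∫ ω, llrErrorWith γ (ω.1, gaussLLR s ω) ∂bitLaw = phi (γ + s) := by
  induction s with
  | top =>
    simp only [llrErrorWith_apply, combinedError, gaussLLR_top_add_coe, llrMean_gaussLLR_top]
    simp [phi_top]
  | coe s =>
    simp only [llrErrorWith_apply, combinedError, gaussLLR_coe, ← EReal.coe_add, ← mul_add,
      llrMean_coe_two_mul, bitOutput]
    rw [integral_bitLaw]
    · simp only [integral_integral_bit_error_eq_phi, add_self_div_two, add_comm s γ,
        ENNReal.coe_add]
    · refine fun b => Integrable.integral_prod_left (f := fun z : ℝ × ℝ => (bpsk b -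
        Real.tanh (√(s : ℝ) * (√(s : ℝ) * bpsk b + z.1) +
          √(γ : ℝ) * (√(γ : ℝ) * bpsk b + z.2))) ^ 2) (ν := gaussianReal 0 1) ?_
      exact .of_bound (by fun_prop) _ (ae_of_all _ fun z => abs_sq_bpsk_sub_tanh_le b _)

end LogLikelihoodRatio

section Codes

variable {n : ℕ} {C : Finset (Fin n → Bool)}

/-- The transmitted antipodal symbols of a codeword. -/
def symbols (c : Fin n → Bool) (j : Fin n) : ℝ := bpsk (c j)

/-- The transmitted antipodal symbols of a codeword, but for the `k`-th. -/
def otherSymbols (k : Fin n) (c : Fin n → Bool) (j : {j : Fin n // j ≠ k}) : ℝ := bpsk (c j)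

/-- The minimum mean squared error of the `k`-th symbol of a codeword given all the
observations. -/
noncomputable def symbolError (C : Finset (Fin n → Bool)) (γ : ℝ) (k : Fin n) : ℝ :=
  mmse C √γ symbols fun c => symbols c k

/-- The minimum mean squared error of the `k`-th symbol of a codeword given the observations of the
other symbols. -/
noncomputable def extrinsicError (C : Finset (Fin n → Bool)) (γ : ℝ) (k : Fin n) : ℝ :=
  mmse C √γ (otherSymbols k) fun c => symbols c k

/-- The posterior probability that the `k`-th bit is `b` given the observations of the other
symbols. -/
noncomputable def bitPosterior (C : Finset (Fin n → Bool)) (a : ℝ) (k : Fin n) (b : Bool) :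
    ({j : Fin n // j ≠ k} → ℝ) → ℝ :=
  posteriorMean C a (otherSymbols k) fun c => if c k = b then 1 else 0

/-- The log likelihood ratio of the `k`-th bit given the observations of the other symbols. -/
noncomputable def posteriorLLR (C : Finset (Fin n → Bool)) (a : ℝ) (k : Fin n)
    (z : {j : Fin n // j ≠ k} → ℝ) : EReal :=
  ENNReal.log (ENNReal.ofReal (bitPosterior C a k true z)) -
    ENNReal.log (ENNReal.ofReal (bitPosterior C a k false z))

lemma bitPosterior_nonneg (hC : C.Nonempty) (a : ℝ) (k : Fin n) (b : Bool)
    (z : {j : Fin n // j ≠ k} → ℝ) : 0 ≤ bitPosterior C a k b z :=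
  div_nonneg (Finset.sum_nonneg fun c _ => mul_nonneg (by dsimp only; split_ifs <;> norm_num)
    (likelihood_pos _ _ _).le) (evidence_pos hC _ _ _).le

lemma sum_mul_bitPosterior (a : ℝ) (k : Fin n) (f : Bool → ℝ) (z : {j : Fin n // j ≠ k} → ℝ) :
    ∑ b, f b * bitPosterior C a k b z =
      posteriorMean C a (otherSymbols k) (fun c => f (c k)) z := by
  simp only [bitPosterior, posteriorMean, mul_div_assoc', ← Finset.sum_div, Finset.mul_sum]
  rw [Finset.sum_comm]
  simp

lemma bitPosterior_add (hC : C.Nonempty) (a : ℝ) (k : Fin n) (z : {j : Fin n // j ≠ k} → ℝ) :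
    bitPosterior C a k true z + bitPosterior C a k false z = 1 := by
  have hone : posteriorMean C a (otherSymbols k) (fun _ => 1) z = 1 := by
    simp only [posteriorMean, one_mul]
    exact div_self (evidence_pos hC _ _ _).ne'
  simpa only [Fintype.sum_bool, one_mul, hone] using
    sum_mul_bitPosterior (C := C) a k (fun _ => 1) z

lemma likelihood_symbols (a : ℝ) (k : Fin n) (c : Fin n → Bool) (y : Fin n → ℝ) :
    likelihood a (symbols c) y = Real.exp (-a ^ 2 / 2) *
      (Real.exp (bpsk (c k) * (a * y k)) * likelihood a (otherSymbols k c) fun j => y j) := by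
  rw [← mul_assoc, ← exp_mul_bpsk_sub, likelihood, likelihood, ← Real.exp_add,
    Fintype.sum_eq_add_sum_subtype_ne _ k]
  rfl

lemma sum_mul_likelihood_symbols (hC : C.Nonempty) (a : ℝ) (k : Fin n) (f : Bool → ℝ)
    (y : Fin n → ℝ) :
    ∑ c ∈ C, f (c k) * likelihood a (symbols c) y =
      (∑ b, f b * Real.exp (bpsk b * (a * y k)) * bitPosterior C a k b fun j => y j) *
        (Real.exp (-a ^ 2 / 2) * evidence C a (otherSymbols k) fun j => y j) := by
  rw [sum_mul_bitPosterior a k fun b => f b * Real.exp (bpsk b * (a * y k)), mul_left_comm,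
    posteriorMean_mul_evidence hC, Finset.mul_sum]
  refine Finset.sum_congr rfl fun c _ => ?_
  rw [likelihood_symbols a k]
  ring

lemma llrMean_posteriorLLR_add (hC : C.Nonempty) (a : ℝ) (k : Fin n) (y : Fin n → ℝ) :
    llrMean (posteriorLLR C a k (fun j => y j) + (2 * (a * y k) : ℝ)) =
      posteriorMean C a symbols (fun c => symbols c k) y := by
  have hne : Real.exp (-a ^ 2 / 2) * evidence C a (otherSymbols k) (fun j => y j) ≠ 0 :=
    mul_ne_zero (Real.exp_pos _).ne' (evidence_pos hC _ _ _).ne'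
  have hsignal := sum_mul_likelihood_symbols hC a k bpsk y
  have hevidence := sum_mul_likelihood_symbols hC a k (fun _ => 1) y
  simp only [one_mul] at hevidence
  rw [posteriorLLR, llrMean_log_sub_log_add (bitPosterior_nonneg hC _ _ _ _)
    (bitPosterior_nonneg hC _ _ _ _) (bitPosterior_add hC _ _ _), posteriorMean, evidence]
  simp only [symbols]
  rw [hsignal, hevidence, mul_div_mul_right _ _ hne]
  simp [bpsk, mul_comm, sub_eq_add_neg]

lemma llrMean_posteriorLLR (hC : C.Nonempty) (a : ℝ) (k : Fin n)
    (z : {j : Fin n // j ≠ k} → ℝ) :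
    llrMean (posteriorLLR C a k z) =
      posteriorMean C a (otherSymbols k) (fun c => symbols c k) z := by
  have hzero := llrMean_log_sub_log_add (bitPosterior_nonneg hC a k true z)
    (bitPosterior_nonneg hC a k false z) (bitPosterior_add hC a k z) 0
  rw [mul_zero, EReal.coe_zero, add_zero, neg_zero, Real.exp_zero, mul_one, mul_one,
    bitPosterior_add hC, div_one] at hzero
  rw [posteriorLLR, hzero]
  simp only [symbols]
  rw [← sum_mul_bitPosterior]
  simp [bpsk, sub_eq_add_neg]

lemma measurePreserving_stdNoise_subtype (k : Fin n) :
    MeasurePreserving (fun m (j : {j : Fin n // j ≠ k}) => m j) (stdNoise (Fin n))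
      (stdNoise {j : Fin n // j ≠ k}) :=
  measurePreserving_subtype_restrict (fun _ => gaussianReal 0 1) (· ≠ k)

@[fun_prop]
lemma measurable_othersOutput (γ : ℝ≥0) (k : Fin n) : Measurable (othersOutput γ k) := by
  unfold othersOutput
  have := measurable_of_countable bpsk
  fun_prop

lemma extProb_ae_eq_bitPosterior (hC : C.Nonempty) (γ : ℝ≥0) (k : Fin n) (b : Bool) :
    extProb C γ k b =ᵐ[codeLaw C] fun ω => bitPosterior C √γ k b (othersOutput γ k ω) := by
  have hmap (c : Fin n → Bool) :
      (stdNoise (Fin n)).map (fun m => othersOutput γ k (c, m)) =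
        (stdNoise {j : Fin n // j ≠ k}).withDensity
          fun z => ENNReal.ofReal (likelihood √γ (otherSymbols k c) z) := by
    have hres := measurePreserving_stdNoise_subtype k
    rw [← stdNoise_map_shift, ← hres.map_eq, Measure.map_map (by fun_prop) hres.measurable]
    rfl
  have hindicator : indicator {ω : (Fin n → Bool) × (Fin n → ℝ) | ω.1 k = b} (fun _ => (1 : ℝ)) =
      fun ω => if ω.1 k = b then 1 else 0 := by
    ext ω
    simp [indicator_apply]
  rw [extProb, hindicator]
  exact condExp_uniformOn_prod hC (measurable_othersOutput γ k)
    (fun c => measurable_likelihood _ _) (fun c => likelihood_pos _ _) hmap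
    fun c => if c k = b then 1 else 0

lemma extLLR_ae_eq_posteriorLLR (hC : C.Nonempty) (γ : ℝ≥0) (k : Fin n) :
    extLLR C γ k =ᵐ[codeLaw C] fun ω => posteriorLLR C √γ k (othersOutput γ k ω) := by
  filter_upwards [extProb_ae_eq_bitPosterior hC γ k true,
    extProb_ae_eq_bitPosterior hC γ k false] with ω htrue hfalse
  rw [extLLR, htrue, hfalse, posteriorLLR]

lemma extMean_eq_sum (hC : C.Nonempty) (γ : ℝ≥0) (f : (Bool × EReal) →ᵇ ℝ)
    {err : Fin n → (Fin n → Bool) → (Fin n → ℝ) → ℝ}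
    (herr : ∀ k c m, f (c k, posteriorLLR C √γ k (othersOutput γ k (c, m))) = err k c m)
    (hint : ∀ k c, Integrable (err k c) (stdNoise (Fin n))) :
    extMean C γ f = (∑ k, (∑ c ∈ C, ∫ m, err k c m ∂stdNoise (Fin n)) / C.card) / n := by
  rw [extMean]
  congr 1
  refine Finset.sum_congr rfl fun k _ => ?_
  have hae : (fun ω => f (ω.1 k, extLLR C γ k ω)) =ᵐ[codeLaw C] fun ω => err k ω.1 ω.2 := by
    filter_upwards [extLLR_ae_eq_posteriorLLR hC γ k] with ω hω
    rw [hω, herr k ω.1 ω.2]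
  rw [integral_congr_ae hae]
  exact integral_uniformOn_prod fun c _ => hint k c

lemma abs_sq_symbols_sub_posteriorMean_le {ι : Type*} [Fintype ι] (hC : C.Nonempty) (a : ℝ)
    (x : (Fin n → Bool) → ι → ℝ) (k : Fin n) (c : Fin n → Bool) (y : ι → ℝ) :
    |(symbols c k - posteriorMean C a x (fun c => symbols c k) y) ^ 2| ≤ (1 + 1) ^ 2 := by
  simpa only [symbols, abs_bpsk] using abs_sq_sub_le (r := bpsk (c k))
    (abs_posteriorMean_le_of_le hC (fun c _ => (abs_bpsk (c k)).le) y)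

lemma integrable_sq_symbols_sub_posteriorMean {ι : Type*} [Fintype ι] (hC : C.Nonempty) (a : ℝ)
    (x : (Fin n → Bool) → ι → ℝ) (k : Fin n) (c : Fin n → Bool) :
    Integrable (fun m => (symbols c k -
      posteriorMean C a x (fun c => symbols c k) fun j => a * x c j + m j) ^ 2) (stdNoise ι) := by
  have hcont := continuous_posteriorMean (a := a) (x := x) (f := fun c => symbols c k) hC
  exact .of_bound (Continuous.aestronglyMeasurable (by fun_prop)) _
    (ae_of_all _ fun m => abs_sq_symbols_sub_posteriorMean_le hC a x k c _)

lemma extMean_llrError (hC : C.Nonempty) (γ : ℝ≥0) :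
    extMean C γ llrError = (∑ k, extrinsicError C γ k) / n := by
  have hres (k : Fin n) := measurePreserving_stdNoise_subtype k
  have hint (k : Fin n) (c : Fin n → Bool) :=
    integrable_sq_symbols_sub_posteriorMean hC √(γ : ℝ) (otherSymbols k) k c
  rw [extMean_eq_sum hC γ llrError
    (fun k c m => by rw [llrError_apply, llrMean_posteriorLLR hC]; rfl)
    fun k c => (hres k).integrable_comp_of_integrable (hint k c)]
  simp only [extrinsicError, mmse, mse]
  congr! 5 with k _ c _
  rw [← (hres k).map_eq, integral_map (hres k).measurable.aemeasurable]
  · rfl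
  · rw [(hres k).map_eq]
    exact (hint k c).aestronglyMeasurable

lemma combinedError_posteriorLLR (hC : C.Nonempty) (γ : ℝ≥0) (k : Fin n) (c : Fin n → Bool)
    (m : Fin n → ℝ) (r : ℝ) :
    combinedError γ (c k) (posteriorLLR C √γ k (othersOutput γ k (c, m))) r =
      (symbols c k - posteriorMean C √γ symbols (fun c => symbols c k)
        fun j => √γ * symbols c j + Function.update m k r j) ^ 2 := by
  have hothers : othersOutput γ k (c, m) = fun j : {j : Fin n // j ≠ k} =>
      √γ * symbols c j + Function.update m k r j := by
    ext j
    rw [Function.update_of_ne j.2]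
    rfl
  rw [← llrMean_posteriorLLR_add hC, hothers, Function.update_self]
  rfl

lemma extMean_llrErrorWith (hC : C.Nonempty) (γ : ℝ≥0) :
    extMean C γ (llrErrorWith γ) = (∑ k, symbolError C γ k) / n := by
  have hint (k : Fin n) (c : Fin n → Bool) :=
    integrable_sq_symbols_sub_posteriorMean hC √(γ : ℝ) symbols k c
  rw [extMean_eq_sum hC γ (llrErrorWith γ)
    (fun k c m => by simp only [llrErrorWith_apply, combinedError_posteriorLLR hC]; rfl)
    fun k c => ((measurePreserving_update (fun _ => gaussianReal 0 1)
      k).integrable_comp_of_integrable (hint k c)).integral_prod_left]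
  simp only [symbolError, mmse, mse]
  congr! 4 with k _ c _
  exact (integral_eq_integral_update _ k (hint k c)).symm

lemma symbolError_le_phi (hC : C.Nonempty) (γ : ℝ≥0) (k : Fin n) :
    symbolError C γ k ≤ phi γ := by
  have herror (c : Fin n → Bool) : ∫ m, (symbols c k -
      Real.tanh (√γ * (√γ * symbols c k + m k))) ^ 2 ∂stdNoise (Fin n) = phi γ := by
    rw [← integral_bit_error_eq_phi γ (c k)]
    exact integral_comp_eval (μ := fun _ : Fin n => gaussianReal 0 1)
      (f := fun t => (bpsk (c k) - Real.tanh (√γ * (√γ * bpsk (c k) + t))) ^ 2) (by fun_prop)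
  have hcard : (C.card : ℝ) ≠ 0 := by exact_mod_cast hC.card_pos.ne'
  calc symbolError C γ k
      ≤ mse C √γ symbols (fun c => symbols c k) fun y => Real.tanh (√γ * y k) :=
        mmse_le_mse hC (by fun_prop) fun y => (Real.abs_tanh_lt_one _).le
    _ = phi γ := by simp [mse, herror, hcard]

lemma integrableOn_sum_symbolError_and_integral_eq (hC : C.Nonempty) :
    IntegrableOn (fun γ : ℝ => ∑ k, symbolError C γ k) (Ioi 0) ∧
      ∫ γ in Ioi (0 : ℝ), ∑ k, symbolError C γ k = 2 * Real.log C.card :=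
  integrableOn_sum_mmse_and_integral_eq hC fun _ _ _ _ h =>
    funext fun j => bpsk_injective (congrFun h j)

lemma extrinsicError_antitone (hC : C.Nonempty) (k : Fin n) :
    Antitone fun γ => extrinsicError C γ k :=
  fun _ _ h => mmse_antitone hC (Real.sqrt_nonneg _) (Real.sqrt_le_sqrt h)

end Codes

section HalfLine

/-- Lebesgue measure on `[0, ∞)`, on which the transfer curve lives. -/
noncomputable def halfLineVolume : Measure ℝ≥0 := Measure.comap (↑) (volume : Measure ℝ)

lemma measurableEmbedding_nnreal_coe : MeasurableEmbedding ((↑) : ℝ≥0 → ℝ) :=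
  .subtype_coe measurableSet_Ici

lemma halfLineVolume_apply (s : Set ℝ≥0) :
    halfLineVolume s = volume ((fun t : ℝ≥0 => (t : ℝ)) '' s) :=
  measurableEmbedding_nnreal_coe.comap_apply _ s

lemma map_coe_halfLineVolume :
    halfLineVolume.map (fun t : ℝ≥0 => (t : ℝ)) = volume.restrict (Ioi 0) := by
  rw [halfLineVolume, measurableEmbedding_nnreal_coe.map_comap, restrict_Ioi_eq_restrict_Ici]
  congr 1
  exact Subtype.range_coe

lemma integrableOn_Ioi_iff_integrable_halfLineVolume {F : ℝ → ℝ} :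
    IntegrableOn F (Ioi 0) ↔ Integrable (fun t : ℝ≥0 => F t) halfLineVolume := by
  rw [IntegrableOn, ← map_coe_halfLineVolume, measurableEmbedding_nnreal_coe.integrable_map_iff]
  rfl

lemma setIntegral_Ioi_eq_integral_halfLineVolume (F : ℝ → ℝ) :
    ∫ t in Ioi 0, F t = ∫ t : ℝ≥0, F t ∂halfLineVolume := by
  rw [← map_coe_halfLineVolume, measurableEmbedding_nnreal_coe.integral_map]

lemma halfLineVolume_Ioo (a b : ℝ≥0) : halfLineVolume (Ioo a b) = ↑(b - a) := by
  rw [halfLineVolume_apply, NNReal.image_coe_Ioo, Real.volume_Ioo, NNReal.sub_def,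
    ENNReal.ofReal]

lemma halfLineVolume_Iio (v : ℝ≥0) : halfLineVolume (Iio v) = v := by
  rw [halfLineVolume_apply, NNReal.image_coe_Iio, Real.volume_Ico, sub_zero,
    ENNReal.ofReal_coe_nnreal]

lemma halfLineVolume_Iic (v : ℝ≥0) : halfLineVolume (Iic v) = v := by
  rw [halfLineVolume_apply, NNReal.image_coe_Iic, Real.volume_Icc, sub_zero,
    ENNReal.ofReal_coe_nnreal]

lemma halfLineVolume_eq_of_ae {X : Set ℝ≥0} {r : ℝ≥0}
    (hlt : ∀ᵐ t ∂halfLineVolume, t < r → t ∈ X) (hle : ∀ᵐ t ∂halfLineVolume, t ∈ X → t ≤ r) :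
    halfLineVolume X = r :=
  le_antisymm ((measure_mono_ae hle).trans_eq (halfLineVolume_Iic r))
    ((halfLineVolume_Iio r).symm.trans_le (measure_mono_ae hlt))

lemma dense_of_halfLineVolume_compl {D : Set ℝ≥0} (hD : halfLineVolume Dᶜ = 0) : Dense D := by
  refine dense_of_exists_between fun a b hab => ?_
  by_contra! hempty
  have hle : halfLineVolume (Ioo a b) ≤ halfLineVolume Dᶜ :=
    measure_mono fun t ht htD => hempty t htD ht
  rw [hD, halfLineVolume_Ioo, nonpos_iff_eq_zero, ENNReal.coe_eq_zero,
    tsub_eq_zero_iff_le] at hle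
  exact hle.not_gt hab

lemma measurableEmbedding_ennreal_coe : MeasurableEmbedding ((↑) : ℝ≥0 → ℝ≥0∞) :=
  ENNReal.isOpenEmbedding_coe.measurableEmbedding

lemma restrict_Iio_top_eq_map_halfLineVolume {μ : Measure ℝ≥0∞}
    (hμ : ∀ v : ℝ≥0, μ (Iio (v : ℝ≥0∞)) = v) :
    μ.restrict (Iio ⊤) = halfLineVolume.map (fun t : ℝ≥0 => (t : ℝ≥0∞)) := by
  have hIio (v : ℝ≥0) : μ.comap (fun t : ℝ≥0 => (t : ℝ≥0∞)) (Iio v) = v := by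
    rw [measurableEmbedding_ennreal_coe.comap_apply, ENNReal.image_coe_Iio, hμ]
  have hcomap : μ.comap (fun t : ℝ≥0 => (t : ℝ≥0∞)) = halfLineVolume := by
    refine Measure.ext_of_generateFrom_of_iUnion (range Iio) (fun i : ℕ => Iio (i : ℝ≥0))
      ((BorelSpace.measurable_eq (α := ℝ≥0)).trans (borel_eq_generateFrom_Iio ℝ≥0)) isPiSystem_Iio
      (iUnion_eq_univ_iff.2 fun t => exists_nat_gt t) (fun i => mem_range_self _)
      (fun i => by simp [hIio]) ?_
    rintro _ ⟨v, rfl⟩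
    rw [hIio, halfLineVolume_Iio]
  rw [← hcomap, measurableEmbedding_ennreal_coe.map_comap]
  congr 1
  exact WithTop.range_coe.symm

end HalfLine

section TransferCurve

variable {D : Set ℝ≥0} {h : ℝ≥0 → ℝ≥0∞} {t s v : ℝ≥0}

/-- The abscissa at which the transfer curve `t ↦ h t`, `t ∈ D`, crosses the antidiagonal
`t + s = v`. -/
noncomputable def crossing (D : Set ℝ≥0) (h : ℝ≥0 → ℝ≥0∞) (v : ℝ≥0) : ℝ≥0 :=
  sSup {t ∈ D | t + h t < v}

lemma le_of_add_lt_coe {x : ℝ≥0∞} (ht : t + x < v) : t ≤ v :=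
  ENNReal.coe_le_coe.1 (le_self_add.trans ht.le)

lemma crossing_le (D : Set ℝ≥0) (h : ℝ≥0 → ℝ≥0∞) (v : ℝ≥0) : crossing D h v ≤ v :=
  csSup_le' fun _ ht => le_of_add_lt_coe ht.2

lemma add_lt_of_lt_crossing (hm : MonotoneOn h D) (ht : t ∈ D) (hlt : t < crossing D h v) :
    t + h t < v := by
  obtain ⟨t', ⟨ht'D, ht'v⟩, htt'⟩ := exists_lt_of_lt_csSup' hlt
  have := hm ht ht'D htt'.le
  exact lt_of_le_of_lt (by gcongr) ht'v

lemma le_crossing (ht : t ∈ D) (hlt : t + h t < v) : t ≤ crossing D h v :=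
  le_csSup ⟨v, fun _ ht' => le_of_add_lt_coe ht'.2⟩ ⟨ht, hlt⟩

lemma apOfExt_add_lt (hD : Dense D) (hs : s < v - crossing D h v) : apOfExt D h s + s < v := by
  obtain ⟨t, htD, hcross, ht⟩ := hD.exists_between (lt_tsub_comm.1 hs)
  have hsum : (t : ℝ≥0∞) + s < v := by exact_mod_cast lt_tsub_iff_right.1 ht
  have hst : (s : ℝ≥0∞) ≤ h t := by
    by_contra! hlt
    exact (le_crossing htD (lt_of_le_of_lt (by gcongr) hsum)).not_gt hcross
  exact lt_of_le_of_lt (by gcongr; exact iInf₂_le t ⟨htD, hst⟩) hsum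

lemma le_apOfExt_add (hD : Dense D) (hm : MonotoneOn h D) (hs : v - crossing D h v < s) :
    v ≤ apOfExt D h s + s := by
  rw [← tsub_le_iff_right]
  refine le_iInf₂ fun t ⟨htD, hst⟩ => ?_
  rw [tsub_le_iff_right]
  by_contra! hlt
  have hsum : t + s < v := by exact_mod_cast hlt
  have hsv : s ≤ v := le_of_add_le_right hsum.le
  have hcross : v - s < crossing D h v :=
    (tsub_lt_iff_right hsv).2 ((tsub_lt_iff_left (crossing_le D h v)).1 hs)
  obtain ⟨t', ht'D, hvt', ht'⟩ := hD.exists_between hcross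
  have htt' : t ≤ t' := (lt_tsub_iff_right.2 hsum).le.trans hvt'.le
  refine (add_lt_of_lt_crossing hm ht'D ht').not_ge ?_
  calc (v : ℝ≥0∞) ≤ t' + s := by exact_mod_cast (tsub_lt_iff_right hsv).1 hvt' |>.le
    _ ≤ t' + h t' := by gcongr; exact hst.trans (hm htD ht'D htt')

lemma halfLineVolume_add_lt_eq_crossing (hD : halfLineVolume Dᶜ = 0) (hm : MonotoneOn h D) :
    halfLineVolume {t | t + h t < v} = crossing D h v := by
  refine halfLineVolume_eq_of_ae ?_ ?_ <;> filter_upwards [compl_mem_ae_iff.2 hD] with t ht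
  · exact add_lt_of_lt_crossing hm (not_not.1 ht)
  · exact le_crossing (not_not.1 ht)

lemma halfLineVolume_apOfExt_add_lt (hD : Dense D) (hm : MonotoneOn h D) :
    halfLineVolume {s : ℝ≥0 | apOfExt D h s + s < v} = ↑(v - crossing D h v) :=
  halfLineVolume_eq_of_ae (ae_of_all _ fun s => apOfExt_add_lt hD)
    (ae_of_all _ fun s hs => not_lt.1 fun hlt => (le_apOfExt_add hD hm hlt).not_gt hs)

lemma apOfExt_monotone (D : Set ℝ≥0) (h : ℝ≥0 → ℝ≥0∞) : Monotone (apOfExt D h) :=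
  fun _ _ hs => biInf_mono fun _ ht => ⟨ht.1, hs.trans ht.2⟩

lemma aemeasurable_of_monotoneOn (hD : halfLineVolume Dᶜ = 0) (hm : MonotoneOn h D) :
    AEMeasurable h halfLineVolume := by
  obtain ⟨g, hg, hgh⟩ := hm.exists_monotone_extension (OrderBot.bddBelow _) (OrderTop.bddAbove _)
  refine ⟨g, hg.measurable, ?_⟩
  filter_upwards [compl_mem_ae_iff.2 hD] with t ht using hgh (not_not.1 ht)

lemma aemeasurable_add_of_monotoneOn (hD : halfLineVolume Dᶜ = 0) (hm : MonotoneOn h D) :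
    AEMeasurable (fun t : ℝ≥0 => t + h t) halfLineVolume :=
  measurable_coe_nnreal_ennreal.aemeasurable.add (aemeasurable_of_monotoneOn hD hm)

lemma measurable_apOfExt_add (D : Set ℝ≥0) (h : ℝ≥0 → ℝ≥0∞) :
    Measurable fun s : ℝ≥0 => apOfExt D h s + s :=
  ((apOfExt_monotone D h).measurable.comp measurable_coe_nnreal_ennreal).add
    measurable_coe_nnreal_ennreal

-- The projections onto the two axes of the part of the curve below the antidiagonal `t + s = v`
-- have total length `v`, for every `v`.
lemma restrict_map_add_map_apOfExt (hD : halfLineVolume Dᶜ = 0) (hm : MonotoneOn h D) :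
    (halfLineVolume.map (fun t : ℝ≥0 => t + h t) +
      halfLineVolume.map fun s : ℝ≥0 => apOfExt D h s + s).restrict (Iio ⊤) =
      halfLineVolume.map (fun u : ℝ≥0 => (u : ℝ≥0∞)) := by
  refine restrict_Iio_top_eq_map_halfLineVolume fun v => ?_
  rw [Measure.add_apply, Measure.map_apply_of_aemeasurable (aemeasurable_add_of_monotoneOn hD hm)
    measurableSet_Iio, Measure.map_apply (measurable_apOfExt_add D h) measurableSet_Iio]
  calc halfLineVolume {t | t + h t < v} + halfLineVolume {s : ℝ≥0 | apOfExt D h s + s < v}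
      = crossing D h v + ↑(v - crossing D h v) := by
        rw [halfLineVolume_add_lt_eq_crossing hD hm,
          halfLineVolume_apOfExt_add_lt (dense_of_halfLineVolume_compl hD) hm]
    _ = v := by rw [← ENNReal.coe_add, add_tsub_cancel_of_le (crossing_le D h v)]

lemma integrable_and_integral_add_integral_apOfExt {E : Type*} [NormedAddCommGroup E]
    [NormedSpace ℝ E] (hD : halfLineVolume Dᶜ = 0) (hm : MonotoneOn h D) {f : ℝ≥0∞ → E}
    (hf_top : f ⊤ = 0) (hf : Integrable (fun u : ℝ≥0 => f u) halfLineVolume) :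
    Integrable (fun s : ℝ≥0 => f (apOfExt D h s + s)) halfLineVolume ∧
      ∫ t, f (t + h t) ∂halfLineVolume + ∫ s : ℝ≥0, f (apOfExt D h s + s) ∂halfLineVolume =
        ∫ u : ℝ≥0, f u ∂halfLineVolume := by
  have hcurve := aemeasurable_add_of_monotoneOn hD hm
  have hinverse := (measurable_apOfExt_add D h).aemeasurable (μ := halfLineVolume)
  have hrestrict := restrict_map_add_map_apOfExt hD hm
  have hsupport : f.support ⊆ Iio ⊤ := by
    rintro u hu
    rw [mem_Iio, lt_top_iff_ne_top]
    rintro rfl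
    exact hu hf_top
  have hsum := (integrableOn_iff_integrable_of_support_subset hsupport).1
    (hrestrict ▸ measurableEmbedding_ennreal_coe.integrable_map_iff.2 hf)
  obtain ⟨hcurve_int, hinverse_int⟩ := integrable_add_measure.1 hsum
  refine ⟨(integrable_map_measure hinverse_int.1 hinverse).1 hinverse_int, ?_⟩
  rw [← integral_map hcurve hcurve_int.1, ← integral_map hinverse hinverse_int.1,
    ← integral_add_measure hcurve_int hinverse_int, ← measurableEmbedding_ennreal_coe.integral_map,
    ← hrestrict, setIntegral_eq_integral_of_forall_compl_eq_zero fun u hu =>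
      Function.notMem_support.1 fun hsupp => hu (hsupport hsupp)]

end TransferCurve

section MeanSymbolError

variable {n : ℕ} {C : Finset (Fin n → Bool)}

lemma integrable_phi_and_integral_eq :
    Integrable (fun γ : ℝ≥0 => phi γ) halfLineVolume ∧
      ∫ γ : ℝ≥0, phi γ ∂halfLineVolume = Real.log 4 := by
  obtain ⟨hint, harea⟩ := integrableOn_phi_and_integral_eq
  rw [integrableOn_Ioi_iff_integrable_halfLineVolume] at hint
  rw [setIntegral_Ioi_eq_integral_halfLineVolume] at harea
  simp only [ENNReal.ofReal_coe_nnreal] at hint harea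
  exact ⟨hint, harea⟩

/-- The error, averaged over the positions of the code, of the estimate of a symbol from all the a
priori observations. -/
noncomputable def meanSymbolError (C : Finset (Fin n → Bool)) (γ : ℝ) : ℝ :=
  (∑ k, symbolError C γ k) / n

lemma meanSymbolError_nonneg (C : Finset (Fin n → Bool)) (γ : ℝ) : 0 ≤ meanSymbolError C γ :=
  div_nonneg (Finset.sum_nonneg fun _ _ => mse_nonneg) n.cast_nonneg

lemma meanSymbolError_le_phi (hC : C.Nonempty) (γ : ℝ≥0) : meanSymbolError C γ ≤ phi γ := by
  refine div_le_of_le_mul₀ n.cast_nonneg (phi_nonneg γ) ?_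
  simpa [mul_comm] using
    Finset.sum_le_card_nsmul Finset.univ _ _ fun k _ => symbolError_le_phi hC γ k

lemma integrable_meanSymbolError_and_integral_eq (hC : C.Nonempty) :
    Integrable (fun γ : ℝ≥0 => meanSymbolError C γ) halfLineVolume ∧
      ∫ γ : ℝ≥0, meanSymbolError C γ ∂halfLineVolume = rate C * Real.log 4 := by
  obtain ⟨hint, harea⟩ := integrableOn_sum_symbolError_and_integral_eq hC
  refine ⟨integrableOn_Ioi_iff_integrable_halfLineVolume.1 (hint.div_const _), ?_⟩
  rw [← setIntegral_Ioi_eq_integral_halfLineVolume]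
  have hlog : Real.log 4 = 2 * Real.log 2 := by
    rw [show (4 : ℝ) = 2 ^ 2 by norm_num, Real.log_pow, Nat.cast_two]
  have hlog_ne : Real.log 2 ≠ 0 := (Real.log_pos one_lt_two).ne'
  simp only [meanSymbolError, integral_div, harea, rate, Real.logb, hlog]
  field_simp

end MeanSymbolError

section TransferLimit

variable {len : ℕ → ℕ} {C : ∀ m, Finset (Fin (len m) → Bool)} {R : ℝ} {D : Set ℝ≥0}
  {γext : ℝ≥0 → ℝ≥0∞}

lemma monotoneOn_of_extrinsicIsGaussian (hC : ∀ m, (C m).Nonempty)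
    (hGauss : ∀ γap ∈ D, ExtrinsicIsGaussian C γap (γext γap)) : MonotoneOn γext D := by
  have hlim (γ : ℝ≥0) (hγ : γ ∈ D) := integral_llrError_gaussLLR (γext γ) ▸ hGauss γ hγ llrError
  intro s hs t ht hst
  refine phi_strictAnti.le_iff_ge.1 (le_of_tendsto_of_tendsto' (hlim t ht) (hlim s hs) fun m => ?_)
  rw [extMean_llrError (hC m), extMean_llrError (hC m)]
  gcongr with k
  exact extrinsicError_antitone (hC m) k (NNReal.coe_le_coe.2 hst)

lemma tendsto_meanSymbolError (hC : ∀ m, (C m).Nonempty) {γ : ℝ≥0} {s : ℝ≥0∞}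
    (hGauss : ExtrinsicIsGaussian C γ s) :
    Tendsto (fun m => meanSymbolError (C m) γ) atTop (𝓝 (phi (γ + s))) := by
  rw [← integral_llrErrorWith_gaussLLR]
  exact (hGauss (llrErrorWith γ)).congr fun m => extMean_llrErrorWith (hC m) γ

lemma integral_phi_add_eq_rate_mul_log (hC : ∀ m, (C m).Nonempty)
    (hR : Tendsto (fun m => rate (C m)) atTop (𝓝 R)) (hD : halfLineVolume Dᶜ = 0)
    (hGauss : ∀ γap ∈ D, ExtrinsicIsGaussian C γap (γext γap)) :
    ∫ γ, phi (γ + γext γ) ∂halfLineVolume = R * Real.log 4 := by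
  have harea (m : ℕ) := integrable_meanSymbolError_and_integral_eq (hC m)
  have hlim : Tendsto (fun m => ∫ γ : ℝ≥0, meanSymbolError (C m) γ ∂halfLineVolume) atTop
      (𝓝 (∫ γ, phi (γ + γext γ) ∂halfLineVolume)) := by
    refine tendsto_integral_of_dominated_convergence (fun γ => phi γ) (fun m => (harea m).1.1)
      integrable_phi_and_integral_eq.1 (fun m => ae_of_all _ fun γ => ?_) ?_
    · rw [Real.norm_of_nonneg (meanSymbolError_nonneg _ _)]
      exact meanSymbolError_le_phi (hC m) γ
    · filter_upwards [compl_mem_ae_iff.2 hD] with γ hγ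
      exact tendsto_meanSymbolError hC (hGauss γ (not_not.1 hγ))
  simp only [(harea _).2] at hlim
  exact tendsto_nhds_unique hlim (hR.mul_const _)

end TransferLimit

end MSEChart

open MSEChart in
theorem lemma2 (len : ℕ → ℕ) (hlen : ∀ m, 0 < len m)
    (C : ∀ m, Finset (Fin (len m) → Bool)) (hC : ∀ m, (C m).Nonempty)
    (R : ℝ) (hR : Tendsto (fun m => MSEChart.rate (C m)) atTop (𝓝 R))
    (D : Set ℝ≥0) (hD : volume ((fun t : ℝ≥0 => (t : ℝ)) '' Dᶜ) = 0) (γext : ℝ≥0 → ℝ≥0∞)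
    (hGauss : ∀ γap ∈ D, MSEChart.ExtrinsicIsGaussian C γap (γext γap)) :
    IntegrableOn
        (fun s : ℝ => MSEChart.phi
          (MSEChart.apOfExt D γext (ENNReal.ofReal s) + ENNReal.ofReal s)) (Ioi 0) ∧
      ∫ s in Ioi (0 : ℝ), MSEChart.phi
          (MSEChart.apOfExt D γext (ENNReal.ofReal s) + ENNReal.ofReal s)
        = (1 - R) * Real.log 4 := by
  have hD' : halfLineVolume Dᶜ = 0 := (halfLineVolume_apply Dᶜ).trans hD
  obtain ⟨hphi, harea⟩ := integrable_phi_and_integral_eq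
  obtain ⟨hint, hsum⟩ := integrable_and_integral_add_integral_apOfExt hD'
    (monotoneOn_of_extrinsicIsGaussian hC hGauss) phi_top hphi
  rw [integral_phi_add_eq_rate_mul_log hC hR hD' hGauss, harea] at hsum
  rw [integrableOn_Ioi_iff_integrable_halfLineVolume, setIntegral_Ioi_eq_integral_halfLineVolume]
  simp only [ENNReal.ofReal_coe_nnreal]
  exact ⟨hint, by linarith⟩
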